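/- Let $p\ge 7$ be a prime, let $m,s\ge 1$ be integers, let $q=p^m$, and suppose that $5\mid(q+1)$ and $5\nmid(q-1)$. A cyclic code of length $n=5p^s$ over $\mathbb F_q$ is a linear subspace of $\mathbb F_q^{n}$ closed under the cyclic shift; vectors $(c_0,\dots,c_{n-1})$ are identified with the classes of $c_0+c_1x+\cdots+c_{n-1}x^{n-1}$ in $\mathbb F_q[x]/(x^{n}-1)$, and $\langle g(x)\rangle$ denotes the code corresponding to the ideal generated by $g(x)$. $d_H(\mathcal C)$ is the minimum Hamming distance, with $d_H(\{\mathbf 0\})=0$. The field $\mathbb F_{q^2}$ contains a primitive $5$-th root of unity $\omega$. For every such $\omega$, the polynomials $f_1(x)=(x-\omega)(x-\omega^4)$ and $f_2(x)=(x-\omega^2)(x-\omega^3)$ have coefficients in $\mathbb F_q$, are irreducible over $\mathbb F_q$, and satisfy $x^5-1=(x-1)f_1(x)f_2(x)$. The cyclic codes of length $5p^s$ over $\mathbb F_q$ are exactly the codes $\langle (x-1)^i f_1(x)^j f_2(x)^k\rangle$ with $0\le i,j,k\le p^s$, and their minimum distances are as follows. Write $l\in I(\tau,\beta)$ for $$p^s-p^{s-\tau}+\beta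 p^{s-\tau-1}+1\le l\le p^s-p^{s-\tau}+(\beta+1)p^{s-\tau-1},$$ where $0\le\tau\le s-1$ and $0\le\beta\le p-2$. Below, $0\le \tau_2\le\tau_1\le\tau_0\le s-1$ and $0\le\beta_0,\beta_1,\beta_2\le p-2$ (only those that occur being considered), and $m_r=(\beta_r+2)p^{\tau_r}$. In each of the four tables, for all exponents satisfying the stated ordering, at least one row applies, and every row that applies gives the value of $d_H(\mathcal C)$. **(A)** $\mathcal C=\langle (x-1)^i f_1^j f_2^k\rangle$ or $\langle (x-1)^i f_2^j f_1^k\rangle$ with $0\le k\le j\le i\le p^s$; $d_H(\mathcal C)$ equals - $1$ if $i=j=k=0$; - $2$ if $0<i\le p^{s-1}$, $0\le j\le p^{s-1}$, $k=0$, or if $p^{s-1}<i\le p^s$, $j=k=0$; - $3$ if $p^{s-1}<i\le 2p^{s-1}$, $0<j\le p^s$, $k=0$; - $4$ if $2p^{s-1}<i\le p^s$, $0<j\le p^s$, $k=0$; - $\min\{m_0,2m_1,4m_2\}$ if $i\in I(\tau_0,\beta_0)$, $j\in I(\tau_1,\beta_1)$, $k\in I(\tau_2,\beta_2)$; - $\min\{2m_1,4m_2\}$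 if $i=p^s$, $j\in I(\tau_1,\beta_1)$, $k\in I(\tau_2,\beta_2)$; - $4m_2$ if $i=j=p^s$, $k\in I(\tau_2,\beta_2)$; - $0$ if $i=j=k=p^s$. **(B)** $\mathcal C=\langle f_1^i (x-1)^j f_2^k\rangle$ with $0\le k\le j\le i\le p^s$; $d_H(\mathcal C)$ equals - $1$ if $i=j=k=0$; - $2$ if $0<i\le p^{s-1}$, $0\le j\le p^{s-1}$, $k=0$; - $3$ if $p^{s-1}<i\le p^s$, $j=k=0$, or if $p^{s-1}<i\le 2p^{s-1}$, $0<j\le p^s$, $k=0$; - $4$ if $2p^{s-1}<i\le p^s$, $0<j\le p^s$, $k=0$; - $\min\{m_0,3m_1,4m_2\}$ if $i\in I(\tau_0,\beta_0)$, $j\in I(\tau_1,\beta_1)$, $k\in I(\tau_2,\beta_2)$; - $\min\{3m_1,4m_2\}$ if $i=p^s$, $j\in I(\tau_1,\beta_1)$, $k\in I(\tau_2,\beta_2)$; - $4m_2$ if $i=j=p^s$, $k\in I(\tau_2,\beta_2)$; - $0$ if $i=j=k=p^s$. **(C)** $\mathcal C=\langle (x-1)^i f_1^j f_2^k\rangle$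 or $\langle (x-1)^i f_2^j f_1^k\rangle$ with $0\le i\le j\le k\le p^s$; $d_H(\mathcal C)$ equals - $1$ if $i=j=k=0$; - $2$ if $i=0$, $0\le j\le p^{s-1}$, $0<k\le p^{s-1}$; - $3$ if $i=j=0$, $p^{s-1}<k\le p^s$, or if $i=0$, $0<j\le p^s$, $p^{s-1}<k\le 2p^{s-1}$; - $4$ if $i=0$, $0<j\le p^s$, $2p^{s-1}<k\le 3p^{s-1}$; - $5$ if $i=0$, $0<j\le p^s$, $3p^{s-1}<k\le p^s$; - $\min\{m_0,3m_1,5m_2\}$ if $i\in I(\tau_2,\beta_2)$, $j\in I(\tau_1,\beta_1)$, $k\in I(\tau_0,\beta_0)$; - $\min\{3m_1,5m_2\}$ if $i\in I(\tau_2,\beta_2)$, $j\in I(\tau_1,\beta_1)$, $k=p^s$; - $5m_2$ if $i\in I(\tau_2,\beta_2)$, $j=k=p^s$; - $0$ if $i=j=k=p^s$. **(D)** $\mathcal C=\langle f_1^i (x-1)^j f_2^k\rangle$ with $0\le i\le j\le k\le p^s$; $d_H(\mathcal C)$ equals - $1$ if $i=j=k=0$; - $2$ if $i=0$, $0\le j\le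 p^{s-1}$, $0<k\le p^{s-1}$; - $3$ if $i=j=0$, $p^{s-1}<k\le p^s$, or if $i=0$, $0<j\le p^s$, $p^{s-1}<k\le 2p^{s-1}$; - $4$ if $i=0$, $0<j\le p^s$, $2p^{s-1}<k\le p^s$; - $\min\{m_0,3m_1,4m_2\}$ if $i\in I(\tau_2,\beta_2)$, $j\in I(\tau_1,\beta_1)$, $k\in I(\tau_0,\beta_0)$; - $\min\{3m_1,4m_2\}$ if $i\in I(\tau_2,\beta_2)$, $j\in I(\tau_1,\beta_1)$, $k=p^s$; - $4m_2$ if $i\in I(\tau_2,\beta_2)$, $j=k=p^s$; - $0$ if $i=j=k=p^s$. -/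

import Mathlib

open Polynomial

namespace CyclicCodes

section Codes

variable {F : Type*} [Field F] {n : ℕ}

/-- The right cyclic shift `(c₀, c₁, …, cₙ₋₁) ↦ (cₙ₋₁, c₀, …, cₙ₋₂)`. -/
def shift (c : Fin n → F) : Fin n → F := fun a => c ((finRotate n).symm a)

/-- A linear code of length `n` over `F` is cyclic if it is closed under the cyclic shift. -/
def IsCyclicCode (C : Submodule F (Fin n → F)) : Prop := ∀ c ∈ C, shift c ∈ C

/-- The identification of the vector `(c₀, …, cₙ₋₁)` with the class of
`c₀ + c₁ x + ⋯ + cₙ₋₁ xⁿ⁻¹` in `F[x] / (xⁿ - 1)`. -/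
noncomputable def toQuotient (F : Type*) [Field F] (n : ℕ) :
    (Fin n → F) →ₗ[F] F[X] ⧸ Ideal.span {(X ^ n - 1 : F[X])} :=
  (Ideal.Quotient.mkₐ F (Ideal.span {(X ^ n - 1 : F[X])})).toLinearMap ∘ₗ
    ∑ a : Fin n, (monomial (a : ℕ)) ∘ₗ (LinearMap.proj a : (Fin n → F) →ₗ[F] F)

/-- The code `⟨g⟩` of length `n`: all vectors whose class in `F[x] / (xⁿ - 1)` lies in the
ideal generated by the class of `g`. -/
noncomputable def generatedBy (n : ℕ) (g : F[X]) : Submodule F (Fin n → F) :=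
  ((Ideal.span {Ideal.Quotient.mk (Ideal.span {(X ^ n - 1 : F[X])}) g}).restrictScalars F).comap
    (toQuotient F n)

open Classical in
/-- The minimum Hamming distance of a linear code. For the zero code the set is empty and the
value is `0`, which is the usual convention for that code. -/
noncomputable def minDist (C : Submodule F (Fin n → F)) : ℕ :=
  sInf {d | ∃ x ∈ C, ∃ y ∈ C, x ≠ y ∧ hammingDist x y = d}

end Codes

/-- `Band p s τ β l` says that
`p^s - p^(s-τ) + β p^(s-τ-1) + 1 ≤ l ≤ p^s - p^(s-τ) + (β+1) p^(s-τ-1)`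
with `0 ≤ β ≤ p - 2` and `0 ≤ τ ≤ s - 1`. -/
def Band (p s τ β l : ℕ) : Prop :=
  τ ≤ s - 1 ∧ β ≤ p - 2 ∧
    p ^ s - p ^ (s - τ) + β * p ^ (s - τ - 1) + 1 ≤ l ∧
    l ≤ p ^ s - p ^ (s - τ) + (β + 1) * p ^ (s - τ - 1)

/-- Distances `d` of `⟨(x-1)^i f^j g^k⟩`, where `k ≤ j ≤ i` and `{f, g} = {f₁, f₂}`. -/
inductive TableLinearTop (p s : ℕ) : (i j k d : ℕ) → Prop
  | whole : TableLinearTop p s 0 0 0 1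
  | two {i j : ℕ} : 0 < i → i ≤ p ^ (s - 1) → j ≤ p ^ (s - 1) → TableLinearTop p s i j 0 2
  | two' {i : ℕ} : p ^ (s - 1) < i → i ≤ p ^ s → TableLinearTop p s i 0 0 2
  | three {i j : ℕ} : p ^ (s - 1) < i → i ≤ 2 * p ^ (s - 1) → 0 < j → j ≤ p ^ s →
      TableLinearTop p s i j 0 3
  | four {i j : ℕ} : 2 * p ^ (s - 1) < i → i ≤ p ^ s → 0 < j → j ≤ p ^ s →
      TableLinearTop p s i j 0 4
  | generic {i j k τ₀ τ₁ τ₂ β₀ β₁ β₂ : ℕ} : τ₂ ≤ τ₁ → τ₁ ≤ τ₀ →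
      Band p s τ₀ β₀ i → Band p s τ₁ β₁ j → Band p s τ₂ β₂ k →
      TableLinearTop p s i j k
        (min ((β₀ + 2) * p ^ τ₀) (min (2 * (β₁ + 2) * p ^ τ₁) (4 * (β₂ + 2) * p ^ τ₂)))
  | full {j k τ₁ τ₂ β₁ β₂ : ℕ} : τ₂ ≤ τ₁ → Band p s τ₁ β₁ j → Band p s τ₂ β₂ k →
      TableLinearTop p s (p ^ s) j k (min (2 * (β₁ + 2) * p ^ τ₁) (4 * (β₂ + 2) * p ^ τ₂))
  | full₂ {k τ₂ β₂ : ℕ} : Band p s τ₂ β₂ k →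
      TableLinearTop p s (p ^ s) (p ^ s) k (4 * (β₂ + 2) * p ^ τ₂)
  | zero : TableLinearTop p s (p ^ s) (p ^ s) (p ^ s) 0

/-- Distances `d` of `⟨f₁^i (x-1)^j f₂^k⟩`, where `k ≤ j ≤ i`. -/
inductive TableLinearMiddleDesc (p s : ℕ) : (i j k d : ℕ) → Prop
  | whole : TableLinearMiddleDesc p s 0 0 0 1
  | two {i j : ℕ} : 0 < i → i ≤ p ^ (s - 1) → j ≤ p ^ (s - 1) →
      TableLinearMiddleDesc p s i j 0 2
  | three' {i : ℕ} : p ^ (s - 1) < i → i ≤ p ^ s → TableLinearMiddleDesc p s i 0 0 3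
  | three {i j : ℕ} : p ^ (s - 1) < i → i ≤ 2 * p ^ (s - 1) → 0 < j → j ≤ p ^ s →
      TableLinearMiddleDesc p s i j 0 3
  | four {i j : ℕ} : 2 * p ^ (s - 1) < i → i ≤ p ^ s → 0 < j → j ≤ p ^ s →
      TableLinearMiddleDesc p s i j 0 4
  | generic {i j k τ₀ τ₁ τ₂ β₀ β₁ β₂ : ℕ} : τ₂ ≤ τ₁ → τ₁ ≤ τ₀ →
      Band p s τ₀ β₀ i → Band p s τ₁ β₁ j → Band p s τ₂ β₂ k →
      TableLinearMiddleDesc p s i j k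
        (min ((β₀ + 2) * p ^ τ₀) (min (3 * (β₁ + 2) * p ^ τ₁) (4 * (β₂ + 2) * p ^ τ₂)))
  | full {j k τ₁ τ₂ β₁ β₂ : ℕ} : τ₂ ≤ τ₁ → Band p s τ₁ β₁ j → Band p s τ₂ β₂ k →
      TableLinearMiddleDesc p s (p ^ s) j k
        (min (3 * (β₁ + 2) * p ^ τ₁) (4 * (β₂ + 2) * p ^ τ₂))
  | full₂ {k τ₂ β₂ : ℕ} : Band p s τ₂ β₂ k →
      TableLinearMiddleDesc p s (p ^ s) (p ^ s) k (4 * (β₂ + 2) * p ^ τ₂)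
  | zero : TableLinearMiddleDesc p s (p ^ s) (p ^ s) (p ^ s) 0

/-- Distances `d` of `⟨(x-1)^i f^j g^k⟩`, where `i ≤ j ≤ k` and `{f, g} = {f₁, f₂}`. -/
inductive TableLinearBottom (p s : ℕ) : (i j k d : ℕ) → Prop
  | whole : TableLinearBottom p s 0 0 0 1
  | two {j k : ℕ} : j ≤ p ^ (s - 1) → 0 < k → k ≤ p ^ (s - 1) → TableLinearBottom p s 0 j k 2
  | three' {k : ℕ} : p ^ (s - 1) < k → k ≤ p ^ s → TableLinearBottom p s 0 0 k 3
  | three {j k : ℕ} : 0 < j → j ≤ p ^ s → p ^ (s - 1) < k → k ≤ 2 * p ^ (s - 1) →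
      TableLinearBottom p s 0 j k 3
  | four {j k : ℕ} : 0 < j → j ≤ p ^ s → 2 * p ^ (s - 1) < k → k ≤ 3 * p ^ (s - 1) →
      TableLinearBottom p s 0 j k 4
  | five {j k : ℕ} : 0 < j → j ≤ p ^ s → 3 * p ^ (s - 1) < k → k ≤ p ^ s →
      TableLinearBottom p s 0 j k 5
  | generic {i j k τ₀ τ₁ τ₂ β₀ β₁ β₂ : ℕ} : τ₂ ≤ τ₁ → τ₁ ≤ τ₀ →
      Band p s τ₂ β₂ i → Band p s τ₁ β₁ j → Band p s τ₀ β₀ k →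
      TableLinearBottom p s i j k
        (min ((β₀ + 2) * p ^ τ₀) (min (3 * (β₁ + 2) * p ^ τ₁) (5 * (β₂ + 2) * p ^ τ₂)))
  | full {i j τ₁ τ₂ β₁ β₂ : ℕ} : τ₂ ≤ τ₁ → Band p s τ₂ β₂ i → Band p s τ₁ β₁ j →
      TableLinearBottom p s i j (p ^ s) (min (3 * (β₁ + 2) * p ^ τ₁) (5 * (β₂ + 2) * p ^ τ₂))
  | full₂ {i τ₂ β₂ : ℕ} : Band p s τ₂ β₂ i →
      TableLinearBottom p s i (p ^ s) (p ^ s) (5 * (β₂ + 2) * p ^ τ₂)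
  | zero : TableLinearBottom p s (p ^ s) (p ^ s) (p ^ s) 0

/-- Distances `d` of `⟨f₁^i (x-1)^j f₂^k⟩`, where `i ≤ j ≤ k`. -/
inductive TableLinearMiddleAsc (p s : ℕ) : (i j k d : ℕ) → Prop
  | whole : TableLinearMiddleAsc p s 0 0 0 1
  | two {j k : ℕ} : j ≤ p ^ (s - 1) → 0 < k → k ≤ p ^ (s - 1) →
      TableLinearMiddleAsc p s 0 j k 2
  | three' {k : ℕ} : p ^ (s - 1) < k → k ≤ p ^ s → TableLinearMiddleAsc p s 0 0 k 3
  | three {j k : ℕ} : 0 < j → j ≤ p ^ s → p ^ (s - 1) < k → k ≤ 2 * p ^ (s - 1) →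
      TableLinearMiddleAsc p s 0 j k 3
  | four {j k : ℕ} : 0 < j → j ≤ p ^ s → 2 * p ^ (s - 1) < k → k ≤ p ^ s →
      TableLinearMiddleAsc p s 0 j k 4
  | generic {i j k τ₀ τ₁ τ₂ β₀ β₁ β₂ : ℕ} : τ₂ ≤ τ₁ → τ₁ ≤ τ₀ →
      Band p s τ₂ β₂ i → Band p s τ₁ β₁ j → Band p s τ₀ β₀ k →
      TableLinearMiddleAsc p s i j k
        (min ((β₀ + 2) * p ^ τ₀) (min (3 * (β₁ + 2) * p ^ τ₁) (4 * (β₂ + 2) * p ^ τ₂)))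
  | full {i j τ₁ τ₂ β₁ β₂ : ℕ} : τ₂ ≤ τ₁ → Band p s τ₂ β₂ i → Band p s τ₁ β₁ j →
      TableLinearMiddleAsc p s i j (p ^ s)
        (min (3 * (β₁ + 2) * p ^ τ₁) (4 * (β₂ + 2) * p ^ τ₂))
  | full₂ {i τ₂ β₂ : ℕ} : Band p s τ₂ β₂ i →
      TableLinearMiddleAsc p s i (p ^ s) (p ^ s) (4 * (β₂ + 2) * p ^ τ₂)
  | zero : TableLinearMiddleAsc p s (p ^ s) (p ^ s) (p ^ s) 0

end CyclicCodes

/-!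
Let `N = p ^ s`. In characteristic `p` one has `X ^ (5 * N) - 1 = (X ^ 5 - 1) ^ N`, so the ideals of
`F[X] / (X ^ (5 * N) - 1)` are generated by the products of powers, with exponents at most `N`, of
the irreducible factors `X - 1`, `f₁`, `f₂` of `X ^ 5 - 1`. Here `f₁` and `f₂` have coefficients in
`F` because the Frobenius map of `F` inverts `ω`, and are irreducible because it does not fix `ω`.

Distances are reduced to the length `5` as follows. Take a nonzero codeword and write it as
`(X ^ 5 - 1) ^ t * v` with `t` maximal, and sort its coefficients by the residue of the exponent
modulo `5`. Each of the five parts is `(X - 1) ^ t` times the corresponding part of `v`; it has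
degree below `N`, and it is nonzero whenever the remainder of `v` modulo `X ^ 5 - 1` has a nonzero
coefficient there. So the weight is at least `minWeight F N t`, the least weight of a nonzero
multiple of `(X - 1) ^ t` of degree below `N`, times the weight of that remainder, and the remainder
is divisible by every factor whose exponent in the generator exceeds `t`
(`min_minWeight_le_card_support`). Conversely `c(X ^ 5) * w ^ N` has weight at most the product of
the weights of `c` and `w` (`exists_card_support_le_min_minWeight`). For exponents `l₁ ≥ l₂ ≥ l₃`
of `g₁`, `g₂`, `g₃` the minimum distance is therefore
`min (M l₁) (min (a * M l₂) (b * M l₃))`, where `M l = minWeight F N l` and `a`, `b` are the minimum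
distances of the codes `⟨g₁⟩`, `⟨g₁ g₂⟩` of length `5` (`minDist_generatedBy_mul_pow`). In each
ordering of the three factors the roots of these generators are consecutive powers of a primitive
fifth root of unity, up to a factor, so by the BCH bound `a = deg g₁ + 1` and
`b = deg (g₁ g₂) + 1` (`minDist_eq_chainDist`).

The function `M` is `1` at `0`, `⊤` at `N`, and `(β + 2) * p ^ τ` on the band with parameters
`τ`, `β` (`minWeight_of_band`). The upper bound there is the weight of the largest power of `X - 1`
whose exponent lies in the band. The lower bound is an induction on `τ`, splitting a polynomial by
residues of exponents modulo a power of `p`, and rests on the fact that a nonzero polynomial of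
degree below `p` divisible by `(X - 1) ^ β` has weight at least `β + 1`. The tables spell out the
resulting minimum.
-/

namespace CyclicCodes

/-! ### Residue parts of a polynomial -/

section ResiduePart

variable {F : Type*} [Field F] {N : ℕ}

/-- The `r`-th residue part of `f` modulo `N`: the polynomial whose `k`-th coefficient is the
coefficient of `f` in degree `N * k + r`, so that `f = ∑ r < N, X ^ r * (residuePart N r f)(X ^ N)`
when `0 < N`. -/
noncomputable def residuePart (N r : ℕ) (f : F[X]) : F[X] :=
  ∑ k ∈ Finset.range (f.natDegree + 1), monomial k (f.coeff (N * k + r))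

theorem coeff_residuePart (hN : 0 < N) (r : ℕ) (f : F[X]) (k : ℕ) :
    (residuePart N r f).coeff k = f.coeff (N * k + r) := by
  simp only [residuePart, finsetSum_coeff, coeff_monomial, Finset.sum_ite_eq', Finset.mem_range]
  split_ifs with h
  · rfl
  · refine (coeff_eq_zero_of_natDegree_lt ?_).symm
    have : k ≤ N * k := Nat.le_mul_of_pos_left k hN
    omega

theorem residuePart_add (hN : 0 < N) (r : ℕ) (f g : F[X]) :
    residuePart N r (f + g) = residuePart N r f + residuePart N r g := by
  ext k; simp [coeff_residuePart hN]

theorem residuePart_expand_mul (hN : 0 < N) {r : ℕ} (hr : r < N) (h f : F[X]) :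
    residuePart N r (expand F N h * f) = h * residuePart N r f := by
  induction h using Polynomial.induction_on' with
  | add a b ha hb => rw [map_add, add_mul, residuePart_add hN, ha, hb, add_mul]
  | monomial n a =>
    ext k
    rw [coeff_residuePart hN, expand_monomial, ← C_mul_X_pow_eq_monomial,
      ← C_mul_X_pow_eq_monomial, mul_assoc, mul_assoc, coeff_C_mul, coeff_C_mul,
      coeff_X_pow_mul', coeff_X_pow_mul']
    congr 1
    by_cases h : n ≤ k
    · obtain ⟨k, rfl⟩ := Nat.exists_eq_add_of_le h
      rw [if_pos (by nlinarith), if_pos h, coeff_residuePart hN]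
      congr 1
      rw [Nat.add_sub_cancel_left, Nat.mul_add, mul_comm n N, add_assoc, Nat.add_sub_cancel_left]
    · rw [if_neg, if_neg h]
      have : N * (k + 1) ≤ N * n := Nat.mul_le_mul_left _ (by omega)
      have e : n * N = N * n := mul_comm _ _
      rw [Nat.mul_add] at this
      omega

theorem sum_X_pow_mul_expand_residuePart (hN : 0 < N) (f : F[X]) :
    ∑ r ∈ Finset.range N, X ^ r * expand F N (residuePart N r f) = f := by
  ext m
  simp only [finsetSum_coeff, coeff_X_pow_mul', coeff_expand hN]
  rw [Finset.sum_eq_single_of_mem (m % N) (Finset.mem_range.2 (Nat.mod_lt m hN))]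
  · rw [if_pos (Nat.mod_le m N), if_pos (Nat.dvd_sub_mod m), coeff_residuePart hN]
    congr 1
    rw [Nat.mul_div_cancel' (Nat.dvd_sub_mod m)]
    exact Nat.sub_add_cancel (Nat.mod_le m N)
  · intro r hr hne
    split_ifs with h1 h2
    · exfalso
      apply hne
      have hm : m = N * ((m - r) / N) + r := by
        rw [Nat.mul_div_cancel' h2]; omega
      rw [hm, Nat.mul_add_mod, Nat.mod_eq_of_lt (Finset.mem_range.1 hr)]
    · rfl
    · rfl

theorem sum_card_support_residuePart (hN : 0 < N) (f : F[X]) :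
    ∑ r ∈ Finset.range N, (residuePart N r f).support.card = f.support.card := by
  rw [Finset.card_eq_sum_card_fiberwise (f := fun m => m % N) (t := Finset.range N)
    (fun m _ => Finset.mem_coe.2 (Finset.mem_range.2 (Nat.mod_lt m hN)))]
  refine Finset.sum_congr rfl fun r hr => ?_
  have hr' := Finset.mem_range.1 hr
  refine Finset.card_bij (fun k _ => N * k + r) ?_ ?_ ?_
  · intro k hk
    rw [mem_support_iff, coeff_residuePart hN] at hk
    simp [hk, Nat.mod_eq_of_lt hr']
  · intro a _ b _ h
    exact Nat.eq_of_mul_eq_mul_left hN (Nat.add_right_cancel h)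
  · intro m hm
    rw [Finset.mem_filter, mem_support_iff] at hm
    have e : N * (m / N) + r = m := by rw [← hm.2]; exact Nat.div_add_mod m N
    exact ⟨m / N, by rw [mem_support_iff, coeff_residuePart hN, e]; exact hm.1, e⟩

theorem exists_residuePart_ne_zero (hN : 0 < N) {f : F[X]} (hf : f ≠ 0) :
    ∃ r < N, residuePart N r f ≠ 0 := by
  by_contra! h
  apply hf
  rw [← sum_X_pow_mul_expand_residuePart hN f]
  exact Finset.sum_eq_zero fun r hr => by rw [h r (Finset.mem_range.1 hr)]; simp

theorem eval_one_eq_sum_residuePart (hN : 0 < N) (f : F[X]) :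
    f.eval 1 = ∑ r ∈ Finset.range N, (residuePart N r f).eval 1 := by
  conv_lhs => rw [← sum_X_pow_mul_expand_residuePart hN f]
  simp [eval_finsetSum, expand_eval]

theorem degree_residuePart_lt (hN : 0 < N) {r D : ℕ} {f : F[X]} (hf : f.degree < (N * D : ℕ)) :
    (residuePart N r f).degree < D := by
  rw [degree_lt_iff_coeff_zero] at hf ⊢
  intro k hk
  rw [coeff_residuePart hN]
  exact hf _ ((Nat.mul_le_mul_left N hk).trans (Nat.le_add_right _ _))

theorem card_support_expand (hN : 0 < N) (f : F[X]) :
    (expand F N f).support.card = f.support.card := by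
  symm
  refine Finset.card_bij (fun k _ => k * N) ?_ ?_ ?_
  · intro k hk; simpa [coeff_expand_mul hN] using hk
  · intro a _ b _ h; exact Nat.eq_of_mul_eq_mul_right hN h
  · intro m hm
    rw [mem_support_iff, coeff_expand hN] at hm
    split_ifs at hm with h
    · exact ⟨m / N, mem_support_iff.2 hm, Nat.div_mul_cancel h⟩
    · exact absurd rfl hm

end ResiduePart

/-! ### Weights of multiples of powers of `X - 1` -/

section Weight

variable {F : Type*} [Field F] {p : ℕ}

theorem card_support_pos {f : F[X]} (hf : f ≠ 0) : 0 < f.support.card := by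
  rwa [Finset.card_pos, support_nonempty]

/-- In characteristic `p` and degree below `p`, the operator `f ↦ X f' - a f` removes exactly the
monomial of degree `a` and lowers the multiplicity of the root `1` by at most one. -/
theorem succ_le_card_support_of_pow_dvd [CharP F p] {β : ℕ} {f : F[X]} (hf : f ≠ 0)
    (hdeg : f.degree < p) (hdvd : (X - 1) ^ β ∣ f) : β + 1 ≤ f.support.card := by
  induction β generalizing f with
  | zero => exact card_support_pos hf
  | succ β ih =>
    obtain ⟨a, ha⟩ := support_nonempty.2 hf
    set g : F[X] := X * derivative f - C (a : F) * f with hg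
    have hcoeff : ∀ r, g.coeff r = ((r : F) - a) * f.coeff r := by
      intro r
      rcases r with _ | r
      · simp [hg]
      · simp [hg, coeff_derivative]; ring
    have hlt : ∀ {r}, r ∈ f.support → r < p := by
      intro r hr
      by_contra h
      exact mem_support_iff.1 hr ((degree_lt_iff_coeff_zero f p).1 hdeg r (by omega))
    have hsub : g.support ⊆ f.support.erase a := by
      intro r hr
      rw [mem_support_iff, hcoeff] at hr
      rw [Finset.mem_erase, mem_support_iff]
      refine ⟨?_, right_ne_zero_of_mul hr⟩
      rintro rfl
      simp at hr
    have hdvdg : (X - 1) ^ β ∣ g := by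
      refine dvd_sub (Dvd.dvd.mul_left ?_ _) (Dvd.dvd.mul_left ?_ _)
      · simpa using pow_sub_one_dvd_derivative_of_pow_dvd hdvd
      · exact (pow_dvd_pow _ (Nat.le_succ β)).trans hdvd
    by_cases hg0 : g = 0
    · exfalso
      have hone : f = monomial a (f.coeff a) := by
        ext r
        rw [coeff_monomial]
        split_ifs with h
        · rw [h]
        · by_contra hr
          have h0 := hcoeff r
          rw [hg0, coeff_zero, eq_comm, mul_eq_zero, or_iff_left hr, sub_eq_zero,
            CharP.natCast_eq_natCast F p] at h0
          exact h (h0.eq_of_lt_of_lt (hlt (mem_support_iff.2 hr)) (hlt ha)).symm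
      have h1 : f.eval 1 = 0 := by
        have : (X - C 1 : F[X]) ∣ f := by
          rw [C_1]; exact (dvd_pow_self _ (by omega)).trans hdvd
        exact dvd_iff_isRoot.1 this
      rw [hone] at h1
      simp at h1
      exact mem_support_iff.1 ha h1
    · have hgdeg : g.degree < p := by
        rw [degree_lt_iff_coeff_zero] at hdeg ⊢
        intro m hm
        rw [hcoeff, hdeg m hm, mul_zero]
      have h1 := ih hg0 hgdeg hdvdg
      have h2 := Finset.card_le_card hsub
      rw [Finset.card_erase_of_mem ha] at h2
      have := card_support_pos hf
      omega

theorem X_sub_one_pow_mul_pow [Fact p.Prime] [CharP F p] (u β : ℕ) :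
    (X - 1 : F[X]) ^ (β * p ^ u) = expand F (p ^ u) ((X - 1) ^ β) := by
  rw [mul_comm, pow_mul, sub_pow_char_pow, one_pow]
  simp

/-- The exponent lies in the first band: the residue parts modulo `p ^ u` are multiples of
`(X - 1) ^ β`, and either one of them is a multiple of `(X - 1) ^ (β + 1)`, or two are nonzero. -/
theorem add_two_le_card_support [Fact p.Prime] [CharP F p] {u β : ℕ} {f : F[X]} (hf : f ≠ 0)
    (hdeg : f.degree < (p ^ (u + 1) : ℕ)) (hdvd : (X - 1) ^ (β * p ^ u + 1) ∣ f) :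
    β + 2 ≤ f.support.card := by
  have hp := (Fact.out : p.Prime).pos
  have hN : 0 < p ^ u := pow_pos hp u
  obtain ⟨h, rfl⟩ := hdvd
  rw [pow_succ, X_sub_one_pow_mul_pow, mul_assoc] at *
  set h' := (X - 1) * h with hh'
  set f := expand F (p ^ u) ((X - 1) ^ β) * h' with hfdef
  have hres : ∀ r < p ^ u, residuePart (p ^ u) r f = (X - 1) ^ β * residuePart (p ^ u) r h' :=
    fun r hr => residuePart_expand_mul hN hr _ _
  have hdegr : ∀ r, (residuePart (p ^ u) r f).degree < p := fun r =>
    degree_residuePart_lt hN (by rwa [← pow_succ])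
  have hb : ∀ r < p ^ u, residuePart (p ^ u) r f ≠ 0 →
      β + 1 ≤ (residuePart (p ^ u) r f).support.card := fun r hr h0 =>
    succ_le_card_support_of_pow_dvd h0 (hdegr r) (hres r hr ▸ dvd_mul_right _ _)
  by_cases hall : ∀ r < p ^ u, (residuePart (p ^ u) r h').eval 1 = 0
  · obtain ⟨r, hr, hr0⟩ := exists_residuePart_ne_zero hN hf
    have h1 : (X - 1) ^ (β + 1) ∣ residuePart (p ^ u) r f := by
      rw [hres r hr, pow_succ]
      refine mul_dvd_mul_left _ ?_
      rw [← C_1]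
      exact dvd_iff_isRoot.2 (hall r hr)
    calc β + 2 ≤ _ := succ_le_card_support_of_pow_dvd hr0 (hdegr r) h1
      _ ≤ _ := Finset.single_le_sum (f := fun r => (residuePart (p ^ u) r f).support.card)
        (fun _ _ => Nat.zero_le _) (Finset.mem_range.2 hr)
      _ = _ := sum_card_support_residuePart hN f
  · push Not at hall
    obtain ⟨r, hr, hr0⟩ := hall
    have hsum := eval_one_eq_sum_residuePart hN h'
    rw [← Finset.add_sum_erase _ _ (Finset.mem_range.2 hr)] at hsum
    have h1 : h'.eval 1 = 0 := by simp [hh']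
    have hex : ∃ r' ∈ (Finset.range (p ^ u)).erase r,
        (residuePart (p ^ u) r' h').eval 1 ≠ 0 := by
      refine Finset.exists_ne_zero_of_sum_ne_zero fun h0 => hr0 ?_
      rw [h0, add_zero, h1] at hsum
      exact hsum.symm
    obtain ⟨r', hr', hr'0⟩ := hex
    have hne : ∀ a < p ^ u, (residuePart (p ^ u) a h').eval 1 ≠ 0 →
        residuePart (p ^ u) a f ≠ 0 := by
      intro a ha h0
      rw [hres a ha]
      refine mul_ne_zero (pow_ne_zero _ (X_sub_C_ne_zero (1 : F))) ?_
      rintro h00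
      simp [h00] at h0
    have hr'lt := Finset.mem_range.1 (Finset.mem_of_mem_erase hr')
    have e1 := hb r hr (hne r hr hr0)
    have e2 := hb r' hr'lt (hne r' hr'lt hr'0)
    rw [← sum_card_support_residuePart hN f, ← Finset.add_sum_erase _ _ (Finset.mem_range.2 hr)]
    have := Finset.single_le_sum (f := fun r => (residuePart (p ^ u) r f).support.card)
        (fun _ _ => Nat.zero_le _) hr'
    omega

/-- The lower bound for all bands, by induction on the number `τ` of the band: a multiple of
`(X - 1) ^ ((p - 1) * N)` of degree below `p * N`, with `N` a power of `p`, is the product of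
`(X ^ N - 1) ^ (p - 1)`, of weight `p`, and a polynomial of degree below `N`. -/
theorem mul_pow_le_card_support [Fact p.Prime] [CharP F p] {τ u β : ℕ} {f : F[X]} (hf : f ≠ 0)
    (hdeg : f.degree < (p ^ (τ + u + 1) : ℕ))
    (hdvd : (X - 1) ^ (p ^ (τ + u + 1) - p ^ (u + 1) + β * p ^ u + 1) ∣ f) :
    (β + 2) * p ^ τ ≤ f.support.card := by
  have hp := (Fact.out : p.Prime).pos
  induction τ generalizing f with
  | zero =>
    rw [zero_add] at *
    rw [Nat.sub_self, zero_add] at hdvd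
    simpa using add_two_le_card_support hf hdeg hdvd
  | succ τ ih =>
    set N := p ^ (τ + u + 1) with hNdef
    have hN : 0 < N := pow_pos hp _
    have hpN : p ^ (τ + 1 + u + 1) = N * p := by rw [hNdef, ← pow_succ]; congr 1; ring
    have hle : p ^ (u + 1) ≤ N := Nat.pow_le_pow_right hp (by omega)
    have hexp : p ^ (τ + 1 + u + 1) - p ^ (u + 1) + β * p ^ u + 1
        = (p - 1) * N + (N - p ^ (u + 1) + β * p ^ u + 1) := by
      rw [hpN]
      obtain ⟨a, ha⟩ : ∃ a, p = a + 1 := ⟨p - 1, by omega⟩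
      have : N * p = (p - 1) * N + N := by
        nth_rw 1 [ha]; rw [show p - 1 = a by omega]; ring
      omega
    rw [hexp, pow_add, X_sub_one_pow_mul_pow] at hdvd
    obtain ⟨h, rfl⟩ := hdvd
    rw [mul_assoc] at *
    set l := N - p ^ (u + 1) + β * p ^ u + 1
    set g := (X - 1) ^ l * h with hg
    have hg0 : g ≠ 0 := right_ne_zero_of_mul hf
    have hgdeg : g.degree < (N : ℕ) := by
      rw [degree_eq_natDegree hf, natDegree_mul (left_ne_zero_of_mul hf) hg0, natDegree_expand,
        natDegree_pow, ← C_1, natDegree_X_sub_C, mul_one, hpN, Nat.cast_lt] at hdeg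
      rw [degree_eq_natDegree hg0, Nat.cast_lt]
      obtain ⟨a, ha⟩ : ∃ a, p = a + 1 := ⟨p - 1, by omega⟩
      have : N * p = (p - 1) * N + N := by
        nth_rw 1 [ha]; rw [show p - 1 = a by omega]; ring
      change (p - 1) * N + _ < _ at hdeg
      omega
    have h1 := ih hg0 hgdeg (dvd_mul_right _ _)
    rw [← sum_card_support_residuePart hN]
    have hsub : g.support ⊆ Finset.range N := by
      intro r hr
      rw [Finset.mem_range]
      by_contra hlt
      exact mem_support_iff.1 hr ((degree_lt_iff_coeff_zero g N).1 hgdeg r (by omega))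
    calc (β + 2) * p ^ (τ + 1) = (β + 2) * p ^ τ * p := by ring
      _ ≤ g.support.card * p := Nat.mul_le_mul_right _ h1
      _ = ∑ _r ∈ g.support, p := by rw [Finset.sum_const, smul_eq_mul]
      _ ≤ _ := Finset.sum_le_sum fun r hr => ?_
      _ ≤ _ := Finset.sum_le_sum_of_subset hsub
    have hrN := Finset.mem_range.1 (hsub hr)
    have h2 : residuePart N r (expand F N ((X - 1) ^ (p - 1)) * g) ≠ 0 := by
      rw [residuePart_expand_mul hN hrN]
      refine mul_ne_zero (pow_ne_zero _ (X_sub_C_ne_zero (1 : F))) fun h0 => ?_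
      have := coeff_residuePart hN r g 0
      rw [h0, mul_zero, zero_add] at this
      exact mem_support_iff.1 hr this.symm
    have h3 := succ_le_card_support_of_pow_dvd (p := p) (β := p - 1) h2
      (degree_residuePart_lt hN (by rwa [← hpN]))
      (by rw [residuePart_expand_mul hN hrN]; exact dvd_mul_right _ _)
    rwa [Nat.sub_add_cancel hp] at h3

theorem card_support_X_sub_one_pow_le [Fact p.Prime] [CharP F p] (τ u β : ℕ) :
    ((X - 1 : F[X]) ^ (p ^ (τ + u + 1) - p ^ (u + 1) + (β + 1) * p ^ u)).support.card
      ≤ (β + 2) * p ^ τ := by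
  have hp := (Fact.out : p.Prime).pos
  have hpow : ∀ n : ℕ, ((X - 1 : F[X]) ^ n).support.card ≤ n + 1 := by
    intro n
    refine (card_supp_le_succ_natDegree _).trans ?_
    rw [natDegree_pow, ← C_1, natDegree_X_sub_C, mul_one]
  have e : p ^ (τ + u + 1) - p ^ (u + 1) = (p ^ τ - 1) * p ^ (u + 1) := by
    rw [Nat.sub_mul, one_mul, ← pow_add, add_assoc]
  rw [e, pow_add, X_sub_one_pow_mul_pow, X_sub_one_pow_mul_pow, mul_comm (β + 2)]
  refine card_support_mul_le.trans ?_
  rw [card_support_expand (pow_pos hp _), card_support_expand (pow_pos hp _)]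
  refine Nat.mul_le_mul ((hpow _).trans ?_) (hpow _)
  have := pow_pos hp τ
  omega

end Weight

/-! ### The least weight of a multiple of a power of `X - 1` -/

section MinWeight

variable {F : Type*} [Field F]

/-- The least weight of a nonzero polynomial of degree less than `N` that is divisible by
`(X - 1) ^ l`; it is `⊤` when there is no such polynomial, that is, when `N ≤ l`. -/
noncomputable def minWeight (F : Type*) [Field F] (N l : ℕ) : ℕ∞ :=
  ⨅ f : {f : F[X] // f ≠ 0 ∧ f.degree < (N : ℕ) ∧ (X - 1) ^ l ∣ f}, (f.1.support.card : ℕ∞)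

theorem minWeight_le {N l : ℕ} {f : F[X]} (hf : f ≠ 0) (hdeg : f.degree < (N : ℕ))
    (hdvd : (X - 1) ^ l ∣ f) : minWeight F N l ≤ f.support.card :=
  iInf_le (fun f : {f : F[X] // f ≠ 0 ∧ f.degree < (N : ℕ) ∧ (X - 1) ^ l ∣ f} =>
    (f.1.support.card : ℕ∞)) ⟨f, hf, hdeg, hdvd⟩

theorem exists_card_support_eq_minWeight {N l : ℕ} (h : minWeight F N l ≠ ⊤) :
    ∃ f : F[X], f ≠ 0 ∧ f.degree < (N : ℕ) ∧ (X - 1) ^ l ∣ f ∧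
      (f.support.card : ℕ∞) = minWeight F N l := by
  rcases isEmpty_or_nonempty {f : F[X] // f ≠ 0 ∧ f.degree < (N : ℕ) ∧ (X - 1) ^ l ∣ f} with he | he
  · exact absurd (iInf_of_empty _) h
  · obtain ⟨f, hf⟩ := ENat.exists_eq_iInf
      (fun f : {f : F[X] // f ≠ 0 ∧ f.degree < (N : ℕ) ∧ (X - 1) ^ l ∣ f} =>
        (f.1.support.card : ℕ∞))
    exact ⟨f.1, f.2.1, f.2.2.1, f.2.2.2, hf⟩

theorem minWeight_mono (N : ℕ) : Monotone (minWeight F N) := fun _ _ h =>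
  le_iInf fun f => minWeight_le f.2.1 f.2.2.1 ((pow_dvd_pow _ h).trans f.2.2.2)

theorem minWeight_zero {N : ℕ} (hN : 0 < N) : minWeight F N 0 = 1 := by
  refine le_antisymm ?_ (le_iInf fun f => ?_)
  · refine (minWeight_le (f := 1) one_ne_zero ?_ (by simp)).trans ?_
    · rw [degree_one]; exact_mod_cast hN
    · exact_mod_cast (card_supp_le_succ_natDegree (1 : F[X])).trans (by simp)
  · exact_mod_cast card_support_pos f.2.1

theorem minWeight_self (N : ℕ) : minWeight F N N = ⊤ := by
  refine iInf_eq_top.2 fun f => absurd f.2.2.1 (not_lt.2 ?_)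
  have h := degree_le_of_dvd f.2.2.2 f.2.1
  have hX : (X - 1 : F[X]).degree = 1 := degree_X_sub_C 1
  rwa [degree_pow, hX, nsmul_one] at h

theorem minWeight_of_band {p s τ β l : ℕ} [Fact p.Prime] [CharP F p] (hs : 0 < s)
    (h : Band p s τ β l) : minWeight F (p ^ s) l = ((β + 2) * p ^ τ : ℕ) := by
  obtain ⟨hτ, hβ, h1, h2⟩ := h
  have hp := (Fact.out : p.Prime).two_le
  obtain ⟨u, rfl⟩ : ∃ u, s = τ + u + 1 := ⟨s - 1 - τ, by omega⟩
  rw [show τ + u + 1 - τ = u + 1 by omega, Nat.add_sub_cancel] at h1 h2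
  refine le_antisymm ?_ (le_iInf fun f => ?_)
  · have hlt : p ^ (τ + u + 1) - p ^ (u + 1) + (β + 1) * p ^ u < p ^ (τ + u + 1) := by
      have e1 : p ^ (u + 1) ≤ p ^ (τ + u + 1) := Nat.pow_le_pow_right (by omega) (by omega)
      have e2 : (β + 1) * p ^ u < p ^ (u + 1) := by
        rw [pow_succ, mul_comm]
        exact Nat.mul_lt_mul_of_pos_left (by omega) (pow_pos (by omega) u)
      omega
    refine (minWeight_le (pow_ne_zero _ (X_sub_C_ne_zero (1 : F))) ?_
      (pow_dvd_pow _ h2)).trans (Nat.cast_le.2 (card_support_X_sub_one_pow_le τ u β))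
    rw [degree_pow, degree_X_sub_C, nsmul_one]
    exact_mod_cast hlt
  · exact Nat.cast_le.2 (mul_pow_le_card_support f.2.1 f.2.2.1 ((pow_dvd_pow _ h1).trans f.2.2.2))

end MinWeight

/-! ### Weights of polynomials modulo `X ^ (e * N) - 1` -/

section RepeatedRoot

variable {F : Type*} [Field F]

theorem expand_X_sub_one_pow (e t : ℕ) : expand F e ((X - 1) ^ t) = (X ^ e - 1) ^ t := by simp

theorem X_pow_sub_one_ne_zero {e : ℕ} (he : 0 < e) : (X ^ e - 1 : F[X]) ≠ 0 := by
  rw [← C_1]; exact X_pow_sub_C_ne_zero he 1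

theorem dvd_of_pow_dvd_mul_pow_mul {g q v : F[X]} {l t : ℕ} (hg : g ≠ 0) (hgq : IsCoprime g q)
    (hlt : t < l) (h : g ^ l ∣ (g * q) ^ t * v) : g ∣ v := by
  have h1 : g ^ t * g ∣ g ^ t * (q ^ t * v) := by
    rw [← pow_succ, ← mul_assoc, ← mul_pow]
    exact (pow_dvd_pow g hlt).trans h
  exact hgq.pow_right.dvd_of_dvd_mul_left ((mul_dvd_mul_iff_left (pow_ne_zero t hg)).1 h1)

/-- The remainder of `v` modulo `X ^ e - 1`, written through the residue parts of `v`. -/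
theorem X_pow_sub_one_dvd_sub_sum_monomial {e : ℕ} (he : 0 < e) (v : F[X]) :
    X ^ e - 1 ∣ v - ∑ r ∈ Finset.range e, monomial r ((residuePart e r v).eval 1) := by
  nth_rw 1 [← sum_X_pow_mul_expand_residuePart he v]
  rw [← Finset.sum_sub_distrib]
  refine Finset.dvd_sum fun r _ => ?_
  rw [← C_mul_X_pow_eq_monomial, mul_comm, ← sub_mul]
  refine Dvd.dvd.mul_right ?_ _
  have h : (X - C 1 : F[X]) ∣ residuePart e r v - C ((residuePart e r v).eval 1) :=
    X_sub_C_dvd_sub_C_eval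
  have := map_dvd (expand F e) h
  simpa using this

/-- If `t` is the exact multiplicity of `X ^ e - 1` in `c = (X ^ e - 1) ^ t * v`, the residue parts
of `c` are `(X - 1) ^ t` times those of `v`. So the weight of `c` is at least the product of
`minWeight F N t` and the weight of the remainder of `v` modulo `X ^ e - 1`, a nonzero word of
length `e` that is divisible by each factor of `X ^ e - 1` whose multiplicity in `c` exceeds `t`. -/
theorem min_minWeight_le_card_support {e N l₁ l₂ l₃ a b : ℕ} (he : 0 < e) {g₁ g₂ g₃ c : F[X]}
    (hg : g₁ * g₂ * g₃ = X ^ e - 1) (h₁₂ : IsCoprime g₁ g₂) (h₁₃ : IsCoprime g₁ g₃)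
    (h₂₃ : IsCoprime g₂ g₃) (ha : ∀ v : F[X], v ≠ 0 → v.degree < (e : ℕ) → g₁ ∣ v →
      a ≤ v.support.card)
    (hb : ∀ v : F[X], v ≠ 0 → v.degree < (e : ℕ) → g₁ * g₂ ∣ v → b ≤ v.support.card)
    (hc : c ≠ 0) (hdeg : c.degree < (e * N : ℕ))
    (hdvd : g₁ ^ l₁ * g₂ ^ l₂ * g₃ ^ l₃ ∣ c) :
    min (minWeight F N l₁) (min (a * minWeight F N l₂) (b * minWeight F N l₃))
      ≤ c.support.card := by
  have hg0 := X_pow_sub_one_ne_zero (F := F) he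
  have hg123 : g₁ * g₂ * g₃ ≠ 0 := hg ▸ hg0
  have hg₁ : g₁ ≠ 0 := left_ne_zero_of_mul (left_ne_zero_of_mul hg123)
  have hg₂ : g₂ ≠ 0 := right_ne_zero_of_mul (left_ne_zero_of_mul hg123)
  have hg₃ : g₃ ≠ 0 := right_ne_zero_of_mul hg123
  obtain ⟨v, hcv, hv⟩ : ∃ v, c = _ * v ∧ ¬ (X ^ e - 1 ∣ v) :=
    (finiteMultiplicity_of_degree_pos_of_monic (by
      rw [← C_1, degree_X_pow_sub_C he]; exact_mod_cast he)
      (by rw [← C_1]; exact monic_X_pow_sub_C _ he.ne') hc).exists_eq_pow_mul_and_not_dvd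
  generalize multiplicity (X ^ e - 1 : F[X]) c = t at hcv
  have hres : ∀ r < e, residuePart e r c = (X - 1) ^ t * residuePart e r v := fun r hr => by
    rw [hcv, ← expand_X_sub_one_pow, residuePart_expand_mul he hr]
  set w : F[X] := ∑ r ∈ Finset.range e, monomial r ((residuePart e r v).eval 1) with hw
  have hvw : X ^ e - 1 ∣ v - w := X_pow_sub_one_dvd_sub_sum_monomial he v
  have hcoeff : ∀ r, w.coeff r = if r < e then (residuePart e r v).eval 1 else 0 := fun r => by
    simp [hw, finsetSum_coeff, coeff_monomial]
  have hw0 : w ≠ 0 := by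
    intro h0; rw [h0, sub_zero] at hvw; exact hv hvw
  have hwdeg : w.degree < (e : ℕ) := by
    rw [degree_lt_iff_coeff_zero]
    intro m hm
    rw [hcoeff, if_neg (not_lt.2 hm)]
  have hdvdw : ∀ g : F[X], g ∣ X ^ e - 1 → g ∣ v → g ∣ w := fun g h1 h2 => by
    have := dvd_sub h2 (h1.trans hvw)
    rwa [sub_sub_cancel] at this
  have hmain : (w.support.card : ℕ∞) * minWeight F N t ≤ c.support.card := by
    rw [← sum_card_support_residuePart he c, Nat.cast_sum, ← nsmul_eq_mul, ← Finset.sum_const]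
    have hsub : w.support ⊆ Finset.range e := by
      intro r hr
      rw [mem_support_iff, hcoeff] at hr
      by_contra h
      rw [if_neg (fun h' => h (Finset.mem_range.2 h'))] at hr
      exact hr rfl
    refine le_trans (Finset.sum_le_sum fun r hr => ?_) (Finset.sum_le_sum_of_subset hsub)
    have hre := Finset.mem_range.1 (hsub hr)
    refine minWeight_le ?_ (degree_residuePart_lt he hdeg) (hres r hre ▸ dvd_mul_right _ _)
    rw [hres r hre]
    refine mul_ne_zero (pow_ne_zero _ (X_sub_C_ne_zero (1 : F))) fun h0 => ?_
    rw [mem_support_iff, hcoeff, h0] at hr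
    simp at hr
  have hv₁ : t < l₁ → g₁ ∣ v := fun h => by
    refine dvd_of_pow_dvd_mul_pow_mul hg₁ (h₁₂.mul_right h₁₃) h (q := g₂ * g₃) ?_
    rw [← mul_assoc, hg, ← hcv]
    exact (Dvd.intro _ (mul_assoc _ _ _).symm).trans hdvd
  have hv₂ : t < l₂ → g₂ ∣ v := fun h => by
    refine dvd_of_pow_dvd_mul_pow_mul hg₂ (h₁₂.symm.mul_right h₂₃) h (q := g₁ * g₃) ?_
    rw [← mul_assoc, mul_comm g₂, hg, ← hcv]
    exact ((Dvd.intro_left _ rfl).mul_right _).trans hdvd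
  have hv₃ : t < l₃ → g₃ ∣ v := fun h => by
    refine dvd_of_pow_dvd_mul_pow_mul hg₃ (h₁₃.symm.mul_right h₂₃.symm) h (q := g₁ * g₂) ?_
    rw [mul_comm g₃, hg, ← hcv]
    exact (Dvd.intro_left _ rfl).trans hdvd
  rcases le_or_gt l₁ t with h1 | h1
  · refine (min_le_left _ _).trans (((minWeight_mono N h1).trans ?_).trans hmain)
    exact le_mul_of_one_le_left' (by exact_mod_cast card_support_pos hw0)
  have hw₁ : g₁ ∣ w := hdvdw g₁ (Dvd.intro _ ((mul_assoc _ _ _).symm.trans hg)) (hv₁ h1)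
  rcases le_or_gt l₂ t with h2 | h2
  · refine ((min_le_right _ _).trans (min_le_left _ _)).trans (le_trans ?_ hmain)
    exact mul_le_mul' (by exact_mod_cast ha w hw0 hwdeg hw₁) (minWeight_mono N h2)
  have hv12 : g₁ * g₂ ∣ v := h₁₂.mul_dvd (hv₁ h1) (hv₂ h2)
  rcases le_or_gt l₃ t with h3 | h3
  · refine ((min_le_right _ _).trans (min_le_right _ _)).trans (le_trans ?_ hmain)
    refine mul_le_mul' ?_ (minWeight_mono N h3)
    exact_mod_cast hb w hw0 hwdeg (hdvdw _ (Dvd.intro _ hg) hv12)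
  · exact absurd (hg ▸ (h₁₃.mul_left h₂₃).mul_dvd hv12 (hv₃ h3)) hv

theorem card_support_pow_char_pow {p : ℕ} [Fact p.Prime] [CharP F p] (s : ℕ) (v : F[X]) :
    (v ^ p ^ s).support.card ≤ v.support.card := by
  rw [← Polynomial.map_iterateFrobenius_expand p v s]
  exact (Finset.card_le_card (support_map_subset _ _)).trans
    (card_support_expand (pow_pos (Fact.out : p.Prime).pos s) v).le

/-- Reducing exponents modulo `n` does not increase the weight. -/
theorem exists_card_support_le_of_X_pow_sub_one {n : ℕ} (hn : 0 < n) (f : F[X]) :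
    ∃ w : F[X], w.degree < (n : ℕ) ∧ X ^ n - 1 ∣ f - w ∧ w.support.card ≤ f.support.card := by
  set w : F[X] := ∑ k ∈ f.support, monomial (k % n) (f.coeff k) with hw
  have hsub : w.support ⊆ f.support.image (· % n) := by
    intro m hm
    rw [mem_support_iff, hw, finsetSum_coeff] at hm
    obtain ⟨k, hk, hk0⟩ := Finset.exists_ne_zero_of_sum_ne_zero hm
    rw [coeff_monomial] at hk0
    split_ifs at hk0 with h
    · exact Finset.mem_image.2 ⟨k, hk, h⟩
    · exact absurd rfl hk0
  refine ⟨w, ?_, ?_, (Finset.card_le_card hsub).trans Finset.card_image_le⟩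
  · rw [degree_lt_iff_coeff_zero]
    intro m hm
    by_contra h
    obtain ⟨k, -, hk⟩ := Finset.mem_image.1 (hsub (mem_support_iff.2 h))
    have := Nat.mod_lt k hn
    omega
  · nth_rw 1 [f.as_sum_support]
    rw [hw, ← Finset.sum_sub_distrib]
    refine Finset.dvd_sum fun k _ => ?_
    rw [← C_mul_X_pow_eq_monomial, ← C_mul_X_pow_eq_monomial, ← mul_sub]
    refine Dvd.dvd.mul_left ?_ _
    nth_rw 1 [← Nat.div_add_mod k n]
    rw [pow_add, pow_mul, ← sub_one_mul]
    exact (sub_one_dvd_pow_sub_one _ _).mul_right _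

/-- The word `f(X ^ e) * v ^ (p ^ s)`, reduced modulo `X ^ (e * p ^ s) - 1`, does not vanish: a
factor `g` of `X ^ e - 1` prime to `v` occurs in it with multiplicity less than `p ^ s`. -/
theorem exists_dvd_card_support_le {p s e : ℕ} [Fact p.Prime] [CharP F p] (he : 0 < e)
    {f v g q G : F[X]} (hf : f ≠ 0) (hdeg : f.degree < (p ^ s : ℕ)) (hg : g * q = X ^ e - 1)
    (hgu : ¬ IsUnit g) (hgq : IsCoprime g q) (hgv : IsCoprime g v)
    (hG : G ∣ expand F e f * v ^ p ^ s) (hGn : G ∣ X ^ (e * p ^ s) - 1) :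
    ∃ w : F[X], w ≠ 0 ∧ w.degree < (e * p ^ s : ℕ) ∧ G ∣ w ∧
      w.support.card ≤ f.support.card * v.support.card := by
  have hp := (Fact.out : p.Prime).pos
  obtain ⟨w, hw, hfw, hcard⟩ := exists_card_support_le_of_X_pow_sub_one
    (n := e * p ^ s) (Nat.mul_pos he (pow_pos hp s)) (expand F e f * v ^ p ^ s)
  refine ⟨w, ?_, hw, ?_, ?_⟩
  · rintro rfl
    rw [sub_zero, pow_mul, ← one_pow (p ^ s), ← sub_pow_char_pow] at hfw
    have h1 : g ^ p ^ s ∣ expand F e f := by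
      refine hgv.pow.dvd_of_dvd_mul_right (dvd_trans (pow_dvd_pow_of_dvd ?_ _) hfw)
      exact Dvd.intro _ hg
    obtain ⟨u, hfu, hu⟩ := (finiteMultiplicity_of_degree_pos_of_monic
      (by rw [degree_X_sub_C]; exact zero_lt_one) (monic_X_sub_C (1 : F))
      hf).exists_eq_pow_mul_and_not_dvd
    generalize multiplicity (X - C 1 : F[X]) f = t at hfu
    have hts : t < p ^ s := by
      have hu0 : u ≠ 0 := by rintro rfl; simp at hu
      rw [hfu, degree_eq_natDegree (hfu ▸ hf), natDegree_mul (pow_ne_zero _ (X_sub_C_ne_zero _))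
        hu0, natDegree_pow, natDegree_X_sub_C, mul_one, Nat.cast_lt] at hdeg
      omega
    have hcop : IsCoprime (X - C 1) u := ((irreducible_X_sub_C (1 : F)).coprime_iff_not_dvd).2 hu
    have hcop' : IsCoprime (X ^ e - 1) (expand F e u) := by
      have := hcop.map (expand F e : F[X] →+* F[X])
      simpa using this
    rw [hfu, map_mul, C_1, expand_X_sub_one_pow, ← hg] at h1
    have h2 : g ∣ expand F e u := by
      refine dvd_of_pow_dvd_mul_pow_mul ?_ hgq hts h1
      rintro rfl
      rw [zero_mul] at hg
      exact X_pow_sub_one_ne_zero he hg.symm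
    exact hgu ((hcop'.of_isCoprime_of_dvd_left (Dvd.intro _ hg)).isUnit_of_dvd' dvd_rfl h2)
  · have := dvd_sub hG (hGn.trans hfw)
    rwa [sub_sub_cancel] at this
  · refine (hcard.trans card_support_mul_le).trans ?_
    rw [card_support_expand he]
    exact Nat.mul_le_mul_left _ (card_support_pow_char_pow s v)

/-- The words `1`, `g₁` and `g₁ * g₂` of length `e`, multiplied by polynomials in `X ^ e` of least
weight, attain the three terms of the minimum. -/
theorem exists_card_support_le_min_minWeight {p s e l₁ l₂ l₃ : ℕ} [Fact p.Prime]
    [CharP F p] (he : 0 < e) {g₁ g₂ g₃ : F[X]} (hg : g₁ * g₂ * g₃ = X ^ e - 1)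
    (h₁₂ : IsCoprime g₁ g₂) (h₁₃ : IsCoprime g₁ g₃) (h₂₃ : IsCoprime g₂ g₃) (hgu : ¬ IsUnit g₃)
    (h32 : l₃ ≤ l₂) (h21 : l₂ ≤ l₁) (h1s : l₁ ≤ p ^ s)
    (hne : min (minWeight F (p ^ s) l₁) (min ((g₁.support.card : ℕ∞) * minWeight F (p ^ s) l₂)
      (((g₁ * g₂).support.card : ℕ∞) * minWeight F (p ^ s) l₃)) ≠ ⊤) :
    ∃ w : F[X], w ≠ 0 ∧ w.degree < (e * p ^ s : ℕ) ∧ g₁ ^ l₁ * g₂ ^ l₂ * g₃ ^ l₃ ∣ w ∧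
      (w.support.card : ℕ∞) ≤ min (minWeight F (p ^ s) l₁)
        (min ((g₁.support.card : ℕ∞) * minWeight F (p ^ s) l₂)
          (((g₁ * g₂).support.card : ℕ∞) * minWeight F (p ^ s) l₃)) := by
  have hg0 := X_pow_sub_one_ne_zero (F := F) he
  have hd₁ : g₁ ∣ X ^ e - 1 := Dvd.intro _ ((mul_assoc _ _ _).symm.trans hg)
  have hd₂ : g₂ ∣ X ^ e - 1 := hg ▸ (Dvd.intro_left _ rfl).mul_right _
  have hd₃ : g₃ ∣ X ^ e - 1 := Dvd.intro_left _ hg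
  -- Divisibility by the product is checked on the three pairwise coprime factors.
  have hmul : ∀ {c : F[X]}, g₁ ^ l₁ ∣ c → g₂ ^ l₂ ∣ c → g₃ ^ l₃ ∣ c →
      g₁ ^ l₁ * g₂ ^ l₂ * g₃ ^ l₃ ∣ c := fun h1 h2 h3 =>
    ((h₁₃.pow).mul_left h₂₃.pow).mul_dvd (h₁₂.pow.mul_dvd h1 h2) h3
  have hGn : g₁ ^ l₁ * g₂ ^ l₂ * g₃ ^ l₃ ∣ X ^ (e * p ^ s) - 1 := by
    rw [pow_mul, ← one_pow (p ^ s), ← sub_pow_char_pow, ← hg, mul_pow, mul_pow]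
    exact mul_dvd_mul (mul_dvd_mul (pow_dvd_pow _ h1s) (pow_dvd_pow _ (h21.trans h1s)))
      (pow_dvd_pow _ (h32.trans (h21.trans h1s)))
  have hexp : ∀ {f g : F[X]} {l l' : ℕ}, g ∣ X ^ e - 1 → l' ≤ l → (X - 1) ^ l ∣ f →
      g ^ l' ∣ expand F e f := fun {f g l l'} h1 h2 h3 => by
    have := map_dvd (expand F e) h3
    rw [expand_X_sub_one_pow] at this
    exact ((pow_dvd_pow _ h2).trans (pow_dvd_pow_of_dvd h1 _)).trans this
  have hkey : ∀ {l : ℕ} {v : F[X]}, IsCoprime g₃ v → minWeight F (p ^ s) l ≠ ⊤ →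
      (∀ f : F[X], (X - 1) ^ l ∣ f → g₁ ^ l₁ * g₂ ^ l₂ * g₃ ^ l₃ ∣ expand F e f * v ^ p ^ s) →
      ∃ w : F[X], w ≠ 0 ∧ w.degree < (e * p ^ s : ℕ) ∧ g₁ ^ l₁ * g₂ ^ l₂ * g₃ ^ l₃ ∣ w ∧
        (w.support.card : ℕ∞) ≤ (v.support.card : ℕ∞) * minWeight F (p ^ s) l := by
    intro l v hgv hl hG
    obtain ⟨f, hf, hfdeg, hfdvd, hfcard⟩ := exists_card_support_eq_minWeight hl
    obtain ⟨w, hw, hwdeg, hwdvd, hwcard⟩ := exists_dvd_card_support_le he hf hfdeg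
      ((mul_comm _ _).trans hg) hgu (h₁₃.symm.mul_right h₂₃.symm) hgv (hG f hfdvd) hGn
    refine ⟨w, hw, hwdeg, hwdvd, ?_⟩
    rw [← hfcard, mul_comm]
    exact_mod_cast hwcard
  have htop : ∀ {v : F[X]} {l : ℕ}, v ≠ 0 → (v.support.card : ℕ∞) * minWeight F (p ^ s) l ≠ ⊤ →
      minWeight F (p ^ s) l ≠ ⊤ := by
    intro v l hv h h0
    rw [h0, ENat.mul_top (by exact_mod_cast (card_support_pos hv).ne')] at h
    exact h rfl
  have hg12 : g₁ * g₂ ≠ 0 := left_ne_zero_of_mul (hg ▸ hg0)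
  have hpow : ∀ {g v : F[X]} {l : ℕ}, l ≤ p ^ s → g ∣ v → g ^ l ∣ v ^ p ^ s := fun h1 h2 =>
    (pow_dvd_pow _ h1).trans (pow_dvd_pow_of_dvd h2 _)
  rcases min_choice (minWeight F (p ^ s) l₁)
    (min ((g₁.support.card : ℕ∞) * minWeight F (p ^ s) l₂)
      (((g₁ * g₂).support.card : ℕ∞) * minWeight F (p ^ s) l₃)) with h | h
  · rw [h] at hne ⊢
    have := hkey (v := 1) isCoprime_one_right hne fun f hf => by
      rw [one_pow, mul_one]
      exact hmul (hexp hd₁ le_rfl hf) (hexp hd₂ h21 hf) (hexp hd₃ (h32.trans h21) hf)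
    have h1 : (1 : F[X]).support.card = 1 := 
      le_antisymm ((card_supp_le_succ_natDegree _).trans (by simp)) (card_support_pos one_ne_zero)
    rwa [h1, Nat.cast_one, one_mul] at this
  · rw [h] at hne ⊢
    rcases min_choice ((g₁.support.card : ℕ∞) * minWeight F (p ^ s) l₂)
      (((g₁ * g₂).support.card : ℕ∞) * minWeight F (p ^ s) l₃) with h' | h'
    · rw [h'] at hne ⊢
      exact hkey h₁₃.symm (htop (left_ne_zero_of_mul hg12) hne) fun f hf =>
        hmul ((hpow h1s dvd_rfl).mul_left _) ((hexp hd₂ le_rfl hf).mul_right _)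
          ((hexp hd₃ h32 hf).mul_right _)
    · rw [h'] at hne ⊢
      exact hkey (h₁₃.symm.mul_right h₂₃.symm) (htop hg12 hne) fun f hf =>
        hmul ((hpow h1s (dvd_mul_right _ _)).mul_left _)
          ((hpow (h21.trans h1s) (dvd_mul_left _ _)).mul_left _) ((hexp hd₃ le_rfl hf).mul_right _)

end RepeatedRoot

/-! ### Cyclic codes as ideals -/

section CodePolynomial

variable {F : Type*} [Field F] {n : ℕ}

/-- The polynomial `c₀ + c₁ x + ⋯ + cₙ₋₁ xⁿ⁻¹` of a vector `(c₀, …, cₙ₋₁)`. -/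
noncomputable def toPoly (F : Type*) [Field F] (n : ℕ) : (Fin n → F) →ₗ[F] F[X] :=
  ∑ a : Fin n, (monomial (a : ℕ)) ∘ₗ (LinearMap.proj a : (Fin n → F) →ₗ[F] F)

theorem toPoly_apply (x : Fin n → F) : toPoly F n x = ∑ a : Fin n, monomial (a : ℕ) (x a) := by
  simp [toPoly]

theorem coeff_toPoly (x : Fin n → F) (a : Fin n) : (toPoly F n x).coeff a = x a := by
  simp [toPoly_apply, finsetSum_coeff, coeff_monomial, Fin.val_inj]

theorem coeff_toPoly_of_le (x : Fin n → F) {m : ℕ} (h : n ≤ m) : (toPoly F n x).coeff m = 0 := by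
  rw [toPoly_apply, finsetSum_coeff]
  exact Finset.sum_eq_zero fun a _ => by rw [coeff_monomial, if_neg (by omega)]

theorem degree_toPoly_lt (x : Fin n → F) : (toPoly F n x).degree < (n : ℕ) :=
  (degree_lt_iff_coeff_zero _ _).2 fun _ h => coeff_toPoly_of_le x h

theorem toPoly_coeff {f : F[X]} (hf : f.degree < (n : ℕ)) :
    toPoly F n (fun a => f.coeff a) = f := by
  ext m
  rcases lt_or_ge m n with h | h
  · exact coeff_toPoly (fun a : Fin n => f.coeff a) ⟨m, h⟩
  · rw [coeff_toPoly_of_le _ h, (degree_lt_iff_coeff_zero _ _).1 hf m h]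

theorem toPoly_injective : Function.Injective (toPoly F n) := fun x y h => by
  ext a; rw [← coeff_toPoly x, h, coeff_toPoly]

theorem card_support_toPoly [DecidableEq F] (x : Fin n → F) :
    (toPoly F n x).support.card = hammingNorm x := by
  rw [hammingNorm]
  symm
  refine Finset.card_bij (fun a _ => (a : ℕ)) ?_ (fun a _ b _ => Fin.ext) ?_
  · intro a ha; simpa [coeff_toPoly] using ha
  · intro m hm
    have hmn : m < n := by
      by_contra h
      exact mem_support_iff.1 hm (coeff_toPoly_of_le x (not_lt.1 h))
    refine ⟨⟨m, hmn⟩, ?_, rfl⟩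
    have := coeff_toPoly x ⟨m, hmn⟩
    simp only at this
    simpa [← this] using hm

theorem toQuotient_apply (x : Fin n → F) :
    toQuotient F n x = Ideal.Quotient.mk (Ideal.span {(X ^ n - 1 : F[X])}) (toPoly F n x) := rfl

theorem mem_generatedBy {g : F[X]} (hg : g ∣ X ^ n - 1) {x : Fin n → F} :
    x ∈ generatedBy n g ↔ g ∣ toPoly F n x := by
  rw [generatedBy, Submodule.mem_comap, Submodule.restrictScalars_mem, toQuotient_apply,
    Ideal.mem_span_singleton]
  refine ⟨?_, fun h => map_dvd _ h⟩
  rintro ⟨h, hh⟩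
  obtain ⟨h, rfl⟩ := Ideal.Quotient.mk_surjective h
  rw [← map_mul, Ideal.Quotient.mk_eq_mk_iff_sub_mem, Ideal.mem_span_singleton] at hh
  have := dvd_add (hg.trans hh) (dvd_mul_right g h)
  rwa [sub_add_cancel] at this

/-- If the weights of the nonzero multiples of `g` of degree less than `n` are at least `E`, and
`E` is attained unless it is `⊤`, then `E` is the minimum distance of `⟨g⟩`; for the zero code both
sides are `0`. -/
theorem minDist_generatedBy {g : F[X]} (hg : g ∣ X ^ n - 1) {E : ℕ∞}
    (hlower : ∀ c : F[X], c ≠ 0 → c.degree < (n : ℕ) → g ∣ c → E ≤ c.support.card)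
    (hupper : E ≠ ⊤ → ∃ c : F[X], c ≠ 0 ∧ c.degree < (n : ℕ) ∧ g ∣ c ∧
      (c.support.card : ℕ∞) ≤ E) :
    minDist (generatedBy n g) = E.toNat := by
  classical
  have hset : ∀ d, (∃ x ∈ generatedBy n g, ∃ y ∈ generatedBy n g, x ≠ y ∧ hammingDist x y = d) ↔
      ∃ c : F[X], c ≠ 0 ∧ c.degree < (n : ℕ) ∧ g ∣ c ∧ c.support.card = d := by
    intro d
    constructor
    · rintro ⟨x, hx, y, hy, hxy, rfl⟩
      refine ⟨toPoly F n (-x + y), ?_, degree_toPoly_lt _, ?_, ?_⟩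
      · rw [Ne, ← map_zero (toPoly F n), toPoly_injective.eq_iff, neg_add_eq_zero]
        exact hxy
      · rw [← mem_generatedBy hg]
        exact add_mem (neg_mem hx) hy
      · rw [card_support_toPoly, hammingDist_eq_hammingNorm]
    · rintro ⟨c, hc, hdeg, hdvd, rfl⟩
      refine ⟨0, zero_mem _, fun a => c.coeff a, ?_, ?_, ?_⟩
      · rwa [mem_generatedBy hg, toPoly_coeff hdeg]
      · rintro h
        have := toPoly_coeff hdeg
        rw [← h, map_zero] at this
        exact hc this.symm
      · rw [hammingDist_eq_hammingNorm, neg_zero, zero_add, ← card_support_toPoly,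
          toPoly_coeff hdeg]
  have hset' : {d | ∃ x ∈ generatedBy n g, ∃ y ∈ generatedBy n g, x ≠ y ∧ hammingDist x y = d} =
      {d | ∃ c : F[X], c ≠ 0 ∧ c.degree < (n : ℕ) ∧ g ∣ c ∧ c.support.card = d} :=
    Set.ext hset
  have hdef : minDist (generatedBy n g) =
      sInf {d | ∃ c : F[X], c ≠ 0 ∧ c.degree < (n : ℕ) ∧ g ∣ c ∧ c.support.card = d} := by
    rw [← hset', minDist]
  rw [hdef]
  by_cases hE : E = ⊤
  · rw [hE, ENat.toNat_top, Nat.sInf_eq_zero]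
    right
    refine Set.eq_empty_of_forall_notMem ?_
    rintro d ⟨c, hc, hdeg, hdvd, -⟩
    have := hlower c hc hdeg hdvd
    rw [hE, top_le_iff] at this
    exact ENat.natCast_ne_top _ this
  · obtain ⟨c, hc, hdeg, hdvd, hcard⟩ := hupper hE
    lift E to ℕ using hE
    rw [ENat.toNat_natCast]
    have h1 : c.support.card = E :=
      le_antisymm (by exact_mod_cast hcard) (by exact_mod_cast hlower c hc hdeg hdvd)
    refine le_antisymm (Nat.sInf_le ⟨c, hc, hdeg, hdvd, h1⟩)
      (le_csInf ⟨_, c, hc, hdeg, hdvd, rfl⟩ ?_)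
    rintro d ⟨c, hc, hdeg, hdvd, rfl⟩
    exact_mod_cast hlower c hc hdeg hdvd

theorem toPoly_shift {k : ℕ} (x : Fin (k + 1) → F) :
    toPoly F (k + 1) (shift x) =
      X * toPoly F (k + 1) x - C (x (Fin.last k)) * (X ^ (k + 1) - 1) := by
  have h1 : toPoly F (k + 1) (shift x) =
      ∑ b : Fin (k + 1), monomial ((finRotate (k + 1) b : Fin (k + 1)) : ℕ) (x b) := by
    rw [toPoly_apply, ← Equiv.sum_comp (finRotate (k + 1))]
    simp [shift]
  rw [h1, toPoly_apply, Fin.sum_univ_castSucc, Fin.sum_univ_castSucc, finRotate_last, mul_add,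
    Finset.mul_sum]
  have h2 : ∀ b : Fin k, ((finRotate (k + 1) b.castSucc : Fin (k + 1)) : ℕ) = b + 1 := fun b => by
    rw [coe_finRotate_of_ne_last (Fin.castSucc_lt_last b).ne, Fin.val_castSucc]
  simp only [h2, Fin.val_castSucc, X_mul_monomial, Fin.val_last, Fin.val_zero]
  rw [← C_mul_X_pow_eq_monomial, ← C_mul_X_pow_eq_monomial]
  ring

theorem isCyclicCode_iff (hn : 0 < n) (C₀ : Submodule F (Fin n → F)) :
    IsCyclicCode C₀ ↔ ∃ g : F[X], g ∣ X ^ n - 1 ∧ C₀ = generatedBy n g := by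
  obtain ⟨k, rfl⟩ : ∃ k, n = k + 1 := ⟨n - 1, by omega⟩
  constructor
  · intro hcyc
    -- The polynomials whose class modulo `X ^ n - 1` is that of a codeword form an ideal.
    let I : Ideal F[X] :=
      { carrier := {f | ∃ x ∈ C₀, X ^ (k + 1) - 1 ∣ f - toPoly F (k + 1) x}
        zero_mem' := ⟨0, zero_mem _, by simp⟩
        add_mem' := by
          rintro f g ⟨x, hx, hfx⟩ ⟨y, hy, hgy⟩
          refine ⟨x + y, add_mem hx hy, ?_⟩
          rw [map_add, add_sub_add_comm]
          exact dvd_add hfx hgy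
        smul_mem' := by
          intro h f hf
          have hX : ∀ f : F[X], (∃ x ∈ C₀, X ^ (k + 1) - 1 ∣ f - toPoly F (k + 1) x) →
              ∃ x ∈ C₀, X ^ (k + 1) - 1 ∣ X * f - toPoly F (k + 1) x := by
            rintro f ⟨x, hx, hfx⟩
            refine ⟨shift x, hcyc x hx, ?_⟩
            rw [toPoly_shift, ← sub_add, ← mul_sub]
            exact dvd_add (hfx.mul_left _) (dvd_mul_left _ _)
          have hXn : ∀ m : ℕ, ∃ x ∈ C₀, X ^ (k + 1) - 1 ∣ X ^ m * f - toPoly F (k + 1) x := by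
            intro m
            induction m with
            | zero => simpa using hf
            | succ m ih => rw [pow_succ' X m, mul_assoc]; exact hX _ ih
          change ∃ x ∈ C₀, X ^ (k + 1) - 1 ∣ h * f - toPoly F (k + 1) x
          induction h using Polynomial.induction_on' with
          | add a b ha hb =>
            obtain ⟨x, hx, hax⟩ := ha
            obtain ⟨y, hy, hby⟩ := hb
            refine ⟨x + y, add_mem hx hy, ?_⟩
            rw [map_add, add_mul, add_sub_add_comm]
            exact dvd_add hax hby
          | monomial m a =>
            obtain ⟨x, hx, hmx⟩ := hXn m
            refine ⟨a • x, C₀.smul_mem a hx, ?_⟩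
            rw [map_smul, ← C_mul_X_pow_eq_monomial, mul_assoc, smul_eq_C_mul, ← mul_sub]
            exact hmx.mul_left _ }
    have hI : ∀ f : F[X], f ∈ I ↔ ∃ x ∈ C₀, X ^ (k + 1) - 1 ∣ f - toPoly F (k + 1) x :=
      fun f => Iff.rfl
    obtain ⟨g, hg⟩ : ∃ g, I = Ideal.span {g} := (IsPrincipalIdealRing.principal I).principal
    have hgn : g ∣ X ^ (k + 1) - 1 := by
      rw [← Ideal.mem_span_singleton, ← hg, hI]
      exact ⟨0, zero_mem _, by simp⟩
    refine ⟨g, hgn, ?_⟩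
    ext x
    rw [mem_generatedBy hgn, ← Ideal.mem_span_singleton, ← hg, hI]
    refine ⟨fun hx => ⟨x, hx, by simp⟩, ?_⟩
    rintro ⟨y, hy, hxy⟩
    have h0 : toPoly F (k + 1) x - toPoly F (k + 1) y = 0 := by
      refine eq_zero_of_dvd_of_degree_lt hxy ?_
      rw [← C_1, degree_X_pow_sub_C (Nat.succ_pos k), ← map_sub]
      exact degree_toPoly_lt _
    rwa [toPoly_injective (sub_eq_zero.1 h0)]
  · rintro ⟨g, hg, rfl⟩ x hx
    rw [mem_generatedBy hg] at hx ⊢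
    rw [toPoly_shift]
    exact dvd_sub (hx.mul_left _) (hg.mul_left _)

theorem generatedBy_eq_of_associated {g h : F[X]} (hg : g ∣ X ^ n - 1) (hgh : Associated g h) :
    generatedBy n g = generatedBy n h := by
  ext x
  rw [mem_generatedBy hg, mem_generatedBy (hgh.symm.dvd.trans hg), hgh.dvd_iff_dvd_left]

/-- The cyclic codes of a length for which `X ^ n - 1` is the `N`-th power of a product of three
irreducible polynomials. -/
theorem isCyclicCode_iff_exists_exponents (hn : 0 < n) {N : ℕ} {g₁ g₂ g₃ : F[X]}
    (h₁ : Irreducible g₁) (h₂ : Irreducible g₂) (h₃ : Irreducible g₃)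
    (hg : X ^ n - 1 = g₁ ^ N * g₂ ^ N * g₃ ^ N) (C₀ : Submodule F (Fin n → F)) :
    IsCyclicCode C₀ ↔ ∃ i j k : ℕ, i ≤ N ∧ j ≤ N ∧ k ≤ N ∧
      C₀ = generatedBy n (g₁ ^ i * g₂ ^ j * g₃ ^ k) := by
  rw [isCyclicCode_iff hn]
  constructor
  · rintro ⟨g, hgn, rfl⟩
    obtain ⟨d, c, hd, hc, hac⟩ := exists_dvd_and_dvd_of_dvd_mul (hg ▸ hgn)
    obtain ⟨a, b, ha, hb, rfl⟩ := exists_dvd_and_dvd_of_dvd_mul hd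
    obtain ⟨i, hi, hai⟩ := (dvd_prime_pow h₁.prime N).1 ha
    obtain ⟨j, hj, hbj⟩ := (dvd_prime_pow h₂.prime N).1 hb
    obtain ⟨k, hk, hck⟩ := (dvd_prime_pow h₃.prime N).1 hc
    refine ⟨i, j, k, hi, hj, hk, generatedBy_eq_of_associated hgn ?_⟩
    rw [hac]
    exact (hai.mul_mul hbj).mul_mul hck
  · rintro ⟨i, j, k, hi, hj, hk, rfl⟩
    refine ⟨_, ?_, rfl⟩
    rw [hg]
    exact mul_dvd_mul (mul_dvd_mul (pow_dvd_pow _ hi) (pow_dvd_pow _ hj)) (pow_dvd_pow _ hk)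

/-- The minimum distance of a repeated-root cyclic code in terms of the weights `a` and `b` of the
simple-root codes `⟨g₁⟩` and `⟨g₁ * g₂⟩` of length `e`, when these weights are attained by `g₁`
and `g₁ * g₂`. -/
theorem minDist_generatedBy_mul_pow {p s e l₁ l₂ l₃ a b : ℕ} [Fact p.Prime] [CharP F p]
    (he : 0 < e) {g₁ g₂ g₃ : F[X]} (hg : g₁ * g₂ * g₃ = X ^ e - 1)
    (h₁₂ : IsCoprime g₁ g₂) (h₁₃ : IsCoprime g₁ g₃) (h₂₃ : IsCoprime g₂ g₃) (hgu : ¬ IsUnit g₃)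
    (ha : ∀ v : F[X], v ≠ 0 → v.degree < (e : ℕ) → g₁ ∣ v → a ≤ v.support.card)
    (ha' : g₁.support.card ≤ a)
    (hb : ∀ v : F[X], v ≠ 0 → v.degree < (e : ℕ) → g₁ * g₂ ∣ v → b ≤ v.support.card)
    (hb' : (g₁ * g₂).support.card ≤ b)
    (h32 : l₃ ≤ l₂) (h21 : l₂ ≤ l₁) (h1s : l₁ ≤ p ^ s) :
    minDist (generatedBy (e * p ^ s) (g₁ ^ l₁ * g₂ ^ l₂ * g₃ ^ l₃)) =
      (min (minWeight F (p ^ s) l₁) (min (a * minWeight F (p ^ s) l₂)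
        (b * minWeight F (p ^ s) l₃))).toNat := by
  refine minDist_generatedBy ?_ (fun c hc hdeg hdvd =>
    min_minWeight_le_card_support he hg h₁₂ h₁₃ h₂₃ ha hb hc hdeg hdvd) fun hne => ?_
  · rw [pow_mul, ← one_pow (p ^ s), ← sub_pow_char_pow, ← hg, mul_pow, mul_pow]
    exact mul_dvd_mul (mul_dvd_mul (pow_dvd_pow _ h1s) (pow_dvd_pow _ (h21.trans h1s)))
      (pow_dvd_pow _ (h32.trans (h21.trans h1s)))
  · have hmono : min (minWeight F (p ^ s) l₁)
        (min ((g₁.support.card : ℕ∞) * minWeight F (p ^ s) l₂)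
          (((g₁ * g₂).support.card : ℕ∞) * minWeight F (p ^ s) l₃)) ≤
        min (minWeight F (p ^ s) l₁) (min (a * minWeight F (p ^ s) l₂)
          (b * minWeight F (p ^ s) l₃)) := by
      gcongr
    obtain ⟨w, hw, hdeg, hdvd, hcard⟩ := exists_card_support_le_min_minWeight he hg h₁₂ h₁₃ h₂₃
      hgu h32 h21 h1s (ne_top_of_le_ne_top hne hmono)
    exact ⟨w, hw, hdeg, hdvd, hcard.trans hmono⟩

end CodePolynomial

/-! ### The tables -/

section Tables

variable {p s : ℕ}

theorem exists_band (hp : 2 ≤ p) (hs : 0 < s) {l : ℕ} (hl : 0 < l) (hlt : l < p ^ s) :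
    ∃ τ β, Band p s τ β l := by
  -- `τ` is the largest number with `p ^ s - p ^ (s - τ) < l`.
  have hex : ∃ τ, l ≤ p ^ s - p ^ (s - (τ + 1)) := ⟨s - 1, by
    rw [Nat.sub_add_cancel hs, Nat.sub_self, pow_zero]; omega⟩
  classical
  set τ := Nat.find hex with hτdef
  have h1 : l ≤ p ^ s - p ^ (s - (τ + 1)) := Nat.find_spec hex
  have h2 : p ^ s - p ^ (s - τ) < l := by
    rcases Nat.eq_zero_or_pos τ with h0 | h0
    · rw [h0, Nat.sub_zero, Nat.sub_self]; exact hl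
    · have := Nat.find_min hex (m := τ - 1) (by omega)
      rw [Nat.sub_add_cancel h0] at this
      omega
  have hτ : τ ≤ s - 1 := Nat.find_min' hex (by
    rw [Nat.sub_add_cancel hs, Nat.sub_self, pow_zero]; omega)
  obtain ⟨u, hu⟩ : ∃ u, s = τ + u + 1 := ⟨s - 1 - τ, by omega⟩
  have e1 : s - τ = u + 1 := by omega
  have e2 : s - (τ + 1) = u := by omega
  rw [e1] at h2
  rw [e2] at h1
  have hle : p ^ (u + 1) ≤ p ^ s := Nat.pow_le_pow_right (by omega) (by omega)
  have hpu : 0 < p ^ u := pow_pos (by omega) u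
  set r := l - (p ^ s - p ^ (u + 1)) - 1 with hr
  have hrlt : r < (p - 1) * p ^ u := by
    rw [Nat.sub_mul, one_mul, ← pow_succ']
    omega
  have h3 := Nat.div_add_mod' r (p ^ u)
  have h4 := Nat.mod_lt r hpu
  have h5 : r / p ^ u < p - 1 := Nat.div_lt_of_lt_mul (by rwa [mul_comm])
  refine ⟨τ, r / p ^ u, hτ, by omega, ?_, ?_⟩ <;>
    generalize r / p ^ u = β at * <;> generalize r % p ^ u = ρ at *
  · rw [e1, Nat.add_sub_cancel]; omega
  · rw [e1, Nat.add_sub_cancel, Nat.add_mul, one_mul]; omega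

theorem Band.le_sub (hp : 2 ≤ p) (hs : 0 < s) {τ β l : ℕ} (h : Band p s τ β l) :
    l ≤ p ^ s - p ^ (s - (τ + 1)) := by
  obtain ⟨hτ, hβ, -, h⟩ := h
  refine h.trans ?_
  obtain ⟨u, hu⟩ : ∃ u, s = τ + u + 1 := ⟨s - 1 - τ, by omega⟩
  rw [show s - τ = u + 1 by omega, show s - (τ + 1) = u by omega, Nat.add_sub_cancel]
  have hle : p ^ (u + 1) ≤ p ^ s := Nat.pow_le_pow_right (by omega) (by omega)
  have : (β + 1) * p ^ u ≤ (p - 1) * p ^ u := Nat.mul_le_mul_right _ (by omega)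
  rw [Nat.sub_mul, one_mul, ← pow_succ'] at this
  have hle' : p ^ u ≤ p ^ (u + 1) := Nat.pow_le_pow_right (by omega) (by omega)
  omega

theorem Band.mono (hp : 2 ≤ p) (hs : 0 < s) {τ β l τ' β' l' : ℕ} (h : Band p s τ β l)
    (h' : Band p s τ' β' l') (hl : l ≤ l') : τ ≤ τ' := by
  by_contra! hlt
  have h1 := h'.le_sub hp hs
  obtain ⟨-, -, h2, -⟩ := h
  have : p ^ (s - τ) ≤ p ^ (s - (τ' + 1)) := Nat.pow_le_pow_right (by omega) (by omega)
  have h3 : p ^ (s - (τ' + 1)) ≤ p ^ s := Nat.pow_le_pow_right (by omega) (by omega)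
  omega

/-- The properties of the function `minWeight F (p ^ s)` from which the tables are computed. -/
structure IsBandWeight (p s : ℕ) (M : ℕ → ℕ∞) : Prop where
  zero : M 0 = 1
  top : M (p ^ s) = ⊤
  mono : Monotone M
  band : ∀ {τ β l}, Band p s τ β l → M l = ((β + 2) * p ^ τ : ℕ)

theorem isBandWeight_minWeight (F : Type*) [Field F] [Fact p.Prime] [CharP F p] (hs : 0 < s) :
    IsBandWeight p s (minWeight F (p ^ s)) where
  zero := minWeight_zero (pow_pos (Fact.out : p.Prime).pos s)
  top := minWeight_self _
  mono := minWeight_mono _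
  band := minWeight_of_band hs

/-- The first band with parameter `β` consists of the `l` for which `l / p ^ (s - 1)`, rounded up,
is `β + 1`. -/
theorem band_zero_iff {β l : ℕ} : Band p s 0 β l ↔
    β ≤ p - 2 ∧ β * p ^ (s - 1) < l ∧ l ≤ (β + 1) * p ^ (s - 1) := by
  simp only [Band, Nat.sub_zero, Nat.sub_self, zero_add, Nat.zero_le, true_and, Nat.succ_le_iff]

namespace IsBandWeight

variable {M : ℕ → ℕ∞}

theorem eq_add_two (h : IsBandWeight p s M) {β l : ℕ} (hβ : β ≤ p - 2)
    (hl : β * p ^ (s - 1) < l) (hl' : l ≤ (β + 1) * p ^ (s - 1)) : M l = (β + 2 : ℕ) := by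
  simpa using h.band (band_zero_iff.2 ⟨hβ, hl, hl'⟩)

theorem add_two_le (h : IsBandWeight p s M) (hp : 2 ≤ p) {β l : ℕ} (hβ : β ≤ p - 2)
    (hl : β * p ^ (s - 1) < l) : (β + 2 : ℕ) ≤ M l := by
  rw [← h.eq_add_two hβ (Nat.lt_succ_self _)]
  · exact h.mono hl
  · rw [Nat.add_mul, one_mul]
    have := pow_pos (show 0 < p by omega) (s - 1)
    omega

theorem one_le (h : IsBandWeight p s M) (l : ℕ) : 1 ≤ M l :=
  h.zero ▸ h.mono (Nat.zero_le l)

theorem two_le (h : IsBandWeight p s M) (hp : 2 ≤ p) {l : ℕ} (hl : 0 < l) : 2 ≤ M l := by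
  simpa using h.add_two_le hp (β := 0) (Nat.zero_le _) (by simpa using hl)

end IsBandWeight

/-- The minimum distance of the code with exponents `l₁ ≥ l₂ ≥ l₃`, when `a` and `b` are the minimum
distances of the simple-root codes generated by the first factor and by the first two. -/
noncomputable def chainDist (M : ℕ → ℕ∞) (a b l₁ l₂ l₃ : ℕ) : ℕ :=
  (min (M l₁) (min (a * M l₂) (b * M l₃))).toNat

section ChainDist

variable {M : ℕ → ℕ∞} {a b d l₁ l₂ l₃ : ℕ}

theorem chainDist_eq_left (h : IsBandWeight p s M) (h₁ : M l₁ = d) (ha : d ≤ a) (hb : d ≤ b) :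
    chainDist M a b l₁ l₂ l₃ = d := by
  have h2 : (d : ℕ∞) ≤ a * M l₂ :=
    (Nat.cast_le.2 ha).trans (le_mul_of_one_le_right' (h.one_le _))
  have h3 : (d : ℕ∞) ≤ b * M l₃ :=
    (Nat.cast_le.2 hb).trans (le_mul_of_one_le_right' (h.one_le _))
  rw [chainDist, h₁, min_eq_left (le_min h2 h3), ENat.toNat_natCast]

theorem le_mul_of_le_two_mul (h : IsBandWeight p s M) (hp : 2 ≤ p) (ha : d ≤ 2 * a)
    (hl : 0 < l₂) : (d : ℕ∞) ≤ a * M l₂ :=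
  calc (d : ℕ∞) ≤ (2 * a : ℕ) := Nat.cast_le.2 ha
    _ = a * 2 := by push_cast; rw [mul_comm]
    _ ≤ a * M l₂ := mul_le_mul_right (h.two_le hp hl) _

theorem chainDist_eq_left_of_pos (h : IsBandWeight p s M) (hp : 2 ≤ p) (h₁ : M l₁ = d)
    (ha : d ≤ 2 * a) (hl : 0 < l₂) (hb : d ≤ b) : chainDist M a b l₁ l₂ l₃ = d := by
  have h3 : (d : ℕ∞) ≤ b * M l₃ :=
    (Nat.cast_le.2 hb).trans (le_mul_of_one_le_right' (h.one_le _))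
  rw [chainDist, h₁, min_eq_left (le_min (le_mul_of_le_two_mul h hp ha hl) h3),
    ENat.toNat_natCast]

theorem chainDist_eq_middle (h : IsBandWeight p s M) (h₁ : (a : ℕ∞) ≤ M l₁) (hb : a ≤ b) :
    chainDist M a b l₁ 0 l₃ = a := by
  have h3 : (a : ℕ∞) ≤ b * M l₃ :=
    (Nat.cast_le.2 hb).trans (le_mul_of_one_le_right' (h.one_le _))
  rw [chainDist, h.zero, mul_one, min_eq_left h3, min_eq_right h₁, ENat.toNat_natCast]

theorem chainDist_eq_right (h : IsBandWeight p s M) (hp : 2 ≤ p) (h₁ : (b : ℕ∞) ≤ M l₁)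
    (ha : b ≤ 2 * a) (hl : 0 < l₂) : chainDist M a b l₁ l₂ 0 = b := by
  rw [chainDist, h.zero, mul_one, min_eq_right (le_mul_of_le_two_mul h hp ha hl), min_eq_right h₁,
    ENat.toNat_natCast]

theorem chainDist_of_band {τ₀ τ₁ τ₂ β₀ β₁ β₂ : ℕ} (h : IsBandWeight p s M) (h₁ : Band p s τ₀ β₀ l₁)
    (h₂ : Band p s τ₁ β₁ l₂) (h₃ : Band p s τ₂ β₂ l₃) : chainDist M a b l₁ l₂ l₃ =
      min ((β₀ + 2) * p ^ τ₀) (min (a * (β₁ + 2) * p ^ τ₁) (b * (β₂ + 2) * p ^ τ₂)) := by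
  rw [chainDist, h.band h₁, h.band h₂, h.band h₃, ← Nat.cast_mul, ← Nat.cast_mul,
    ← Nat.mono_cast.map_min, ← Nat.mono_cast.map_min, ENat.toNat_natCast, mul_assoc, mul_assoc]

theorem chainDist_full {τ₁ τ₂ β₁ β₂ : ℕ} (h : IsBandWeight p s M)
    (h₂ : Band p s τ₁ β₁ l₂) (h₃ : Band p s τ₂ β₂ l₃) : chainDist M a b (p ^ s) l₂ l₃ =
      min (a * (β₁ + 2) * p ^ τ₁) (b * (β₂ + 2) * p ^ τ₂) := by
  rw [chainDist, h.top, min_eq_right le_top, h.band h₂, h.band h₃, ← Nat.cast_mul, ← Nat.cast_mul,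
    ← Nat.mono_cast.map_min, ENat.toNat_natCast, mul_assoc, mul_assoc]

theorem chainDist_full₂ {τ₂ β₂ : ℕ} (h : IsBandWeight p s M) (ha : a ≠ 0)
    (h₃ : Band p s τ₂ β₂ l₃) :
    chainDist M a b (p ^ s) (p ^ s) l₃ = b * (β₂ + 2) * p ^ τ₂ := by
  rw [chainDist, h.top, ENat.mul_top (by exact_mod_cast ha), min_eq_right le_top,
    min_eq_right le_top, h.band h₃, ← Nat.cast_mul, ENat.toNat_natCast, mul_assoc]

theorem chainDist_full₃ (h : IsBandWeight p s M) (ha : a ≠ 0) (hb : b ≠ 0) :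
    chainDist M a b (p ^ s) (p ^ s) (p ^ s) = 0 := by
  rw [chainDist, h.top, ENat.mul_top (by exact_mod_cast ha), ENat.mul_top (by exact_mod_cast hb)]
  simp

end ChainDist

theorem exists_bands (hp : 2 ≤ p) (hs : 0 < s) {l₁ l₂ l₃ : ℕ} (h₃ : 0 < l₃) (h32 : l₃ ≤ l₂)
    (h21 : l₂ ≤ l₁) (h₁ : l₁ ≤ p ^ s) :
    (∃ τ₀ τ₁ τ₂ β₀ β₁ β₂, τ₂ ≤ τ₁ ∧ τ₁ ≤ τ₀ ∧ Band p s τ₀ β₀ l₁ ∧ Band p s τ₁ β₁ l₂ ∧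
      Band p s τ₂ β₂ l₃) ∨
    (l₁ = p ^ s ∧ ∃ τ₁ τ₂ β₁ β₂, τ₂ ≤ τ₁ ∧ Band p s τ₁ β₁ l₂ ∧ Band p s τ₂ β₂ l₃) ∨
    (l₁ = p ^ s ∧ l₂ = p ^ s ∧ ∃ τ₂ β₂, Band p s τ₂ β₂ l₃) ∨
    (l₁ = p ^ s ∧ l₂ = p ^ s ∧ l₃ = p ^ s) := by
  rcases (h32.trans (h21.trans h₁)).eq_or_lt with e3 | e3
  · right; right; right; omega
  obtain ⟨τ₂, β₂, b₂⟩ := exists_band hp hs h₃ e3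
  rcases (h21.trans h₁).eq_or_lt with e2 | e2
  · exact Or.inr (Or.inr (Or.inl ⟨by omega, e2, τ₂, β₂, b₂⟩))
  obtain ⟨τ₁, β₁, b₁⟩ := exists_band hp hs (h₃.trans_le h32) e2
  rcases h₁.eq_or_lt with e1 | e1
  · exact Or.inr (Or.inl ⟨e1, τ₁, τ₂, β₁, β₂, b₂.mono hp hs b₁ h32, b₁, b₂⟩)
  obtain ⟨τ₀, β₀, b₀⟩ := exists_band hp hs (h₃.trans_le (h32.trans h21)) e1
  exact Or.inl ⟨τ₀, τ₁, τ₂, β₀, β₁, β₂, b₂.mono hp hs b₁ h32, b₁.mono hp hs b₀ h21, b₀, b₁, b₂⟩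

/-- A relation that holds for some value and determines it is equality with that value. -/
theorem iff_eq_of_exists {T : ℕ → Prop} {D : ℕ} (hT : ∀ d, T d → D = d) (hex : ∃ d, T d) (d : ℕ) :
    T d ↔ D = d := by
  refine ⟨hT d, ?_⟩
  rintro rfl
  obtain ⟨d, hd⟩ := hex
  rwa [hT d hd]

variable {M : ℕ → ℕ∞} {i j k : ℕ}

theorem tableLinearTop_iff (h : IsBandWeight p s M) (hp7 : 7 ≤ p) (hs : 0 < s) (hkj : k ≤ j)
    (hji : j ≤ i) (hi : i ≤ p ^ s) (d : ℕ) :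
    TableLinearTop p s i j k d ↔ chainDist M 2 4 i j k = d := by
  have hp : 2 ≤ p := by omega
  have hP : 0 < p ^ (s - 1) := pow_pos (by omega) _
  refine iff_eq_of_exists (T := TableLinearTop p s i j k) (fun d hd => ?_) ?_ d
  · cases hd with
    | whole => exact chainDist_eq_left h (by simpa using h.zero) (by omega) (by omega)
    | two h1 h2 h3 =>
      exact chainDist_eq_left h (h.eq_add_two (β := 0) (by omega) (by omega) (by omega))
        (by omega) (by omega)
    | two' h1 h2 => exact chainDist_eq_middle h (h.two_le hp (by omega)) (by omega)
    | three h1 h2 h3 h4 =>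
      exact chainDist_eq_left_of_pos h hp (h.eq_add_two (β := 1) (by omega) (by omega) (by omega))
        (by omega) h3 (by omega)
    | four h1 h2 h3 h4 =>
      exact chainDist_eq_right h hp (h.add_two_le hp (β := 2) (by omega) h1) (by omega) h3
    | generic _ _ h1 h2 h3 => exact chainDist_of_band h h1 h2 h3
    | full _ h2 h3 => exact chainDist_full h h2 h3
    | full₂ h3 => exact chainDist_full₂ h (by omega) h3
    | zero => exact chainDist_full₃ h (by omega) (by omega)
  · rcases Nat.eq_zero_or_pos k with rfl | hk
    · rcases Nat.eq_zero_or_pos j with rfl | hj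
      · rcases Nat.eq_zero_or_pos i with rfl | hi0
        · exact ⟨_, .whole⟩
        rcases le_or_gt i (p ^ (s - 1)) with h1 | h1
        · exact ⟨_, .two hi0 h1 (by omega)⟩
        · exact ⟨_, .two' h1 hi⟩
      rcases le_or_gt i (p ^ (s - 1)) with h1 | h1
      · exact ⟨_, .two (by omega) h1 (by omega)⟩
      rcases le_or_gt i (2 * p ^ (s - 1)) with h2 | h2
      · exact ⟨_, .three h1 h2 hj (by omega)⟩
      · exact ⟨_, .four h2 hi hj (by omega)⟩
    · obtain ⟨τ₀, τ₁, τ₂, β₀, β₁, β₂, h1, h2, b₀, b₁, b₂⟩ | ⟨rfl, τ₁, τ₂, β₁, β₂, h1, b₁, b₂⟩ |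
        ⟨rfl, rfl, τ₂, β₂, b₂⟩ | ⟨rfl, rfl, rfl⟩ := exists_bands hp hs hk hkj hji hi
      · exact ⟨_, .generic h1 h2 b₀ b₁ b₂⟩
      · exact ⟨_, .full h1 b₁ b₂⟩
      · exact ⟨_, .full₂ b₂⟩
      · exact ⟨_, .zero⟩

theorem tableLinearMiddleDesc_iff (h : IsBandWeight p s M) (hp7 : 7 ≤ p) (hs : 0 < s)
    (hkj : k ≤ j) (hji : j ≤ i) (hi : i ≤ p ^ s) (d : ℕ) :
    TableLinearMiddleDesc p s i j k d ↔ chainDist M 3 4 i j k = d := by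
  have hp : 2 ≤ p := by omega
  have hP : 0 < p ^ (s - 1) := pow_pos (by omega) _
  refine iff_eq_of_exists (T := TableLinearMiddleDesc p s i j k) (fun d hd => ?_) ?_ d
  · cases hd with
    | whole => exact chainDist_eq_left h (by simpa using h.zero) (by omega) (by omega)
    | two h1 h2 h3 =>
      exact chainDist_eq_left h (h.eq_add_two (β := 0) (by omega) (by omega) (by omega))
        (by omega) (by omega)
    | three' h1 h2 =>
      exact chainDist_eq_middle h (h.add_two_le hp (β := 1) (by omega) (by omega)) (by omega)
    | three h1 h2 h3 h4 =>
      exact chainDist_eq_left h (h.eq_add_two (β := 1) (by omega) (by omega) (by omega))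
        (by omega) (by omega)
    | four h1 h2 h3 h4 =>
      exact chainDist_eq_right h hp (h.add_two_le hp (β := 2) (by omega) h1) (by omega) h3
    | generic _ _ h1 h2 h3 => exact chainDist_of_band h h1 h2 h3
    | full _ h2 h3 => exact chainDist_full h h2 h3
    | full₂ h3 => exact chainDist_full₂ h (by omega) h3
    | zero => exact chainDist_full₃ h (by omega) (by omega)
  · rcases Nat.eq_zero_or_pos k with rfl | hk
    · rcases Nat.eq_zero_or_pos j with rfl | hj
      · rcases Nat.eq_zero_or_pos i with rfl | hi0
        · exact ⟨_, .whole⟩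
        rcases le_or_gt i (p ^ (s - 1)) with h1 | h1
        · exact ⟨_, .two hi0 h1 (by omega)⟩
        · exact ⟨_, .three' h1 hi⟩
      rcases le_or_gt i (p ^ (s - 1)) with h1 | h1
      · exact ⟨_, .two (by omega) h1 (by omega)⟩
      rcases le_or_gt i (2 * p ^ (s - 1)) with h2 | h2
      · exact ⟨_, .three h1 h2 hj (by omega)⟩
      · exact ⟨_, .four h2 hi hj (by omega)⟩
    · obtain ⟨τ₀, τ₁, τ₂, β₀, β₁, β₂, h1, h2, b₀, b₁, b₂⟩ | ⟨rfl, τ₁, τ₂, β₁, β₂, h1, b₁, b₂⟩ |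
        ⟨rfl, rfl, τ₂, β₂, b₂⟩ | ⟨rfl, rfl, rfl⟩ := exists_bands hp hs hk hkj hji hi
      · exact ⟨_, .generic h1 h2 b₀ b₁ b₂⟩
      · exact ⟨_, .full h1 b₁ b₂⟩
      · exact ⟨_, .full₂ b₂⟩
      · exact ⟨_, .zero⟩

theorem tableLinearBottom_iff (h : IsBandWeight p s M) (hp7 : 7 ≤ p) (hs : 0 < s) (hij : i ≤ j)
    (hjk : j ≤ k) (hk : k ≤ p ^ s) (d : ℕ) :
    TableLinearBottom p s i j k d ↔ chainDist M 3 5 k j i = d := by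
  have hp : 2 ≤ p := by omega
  have hP : 0 < p ^ (s - 1) := pow_pos (by omega) _
  refine iff_eq_of_exists (T := TableLinearBottom p s i j k) (fun d hd => ?_) ?_ d
  · cases hd with
    | whole => exact chainDist_eq_left h (by simpa using h.zero) (by omega) (by omega)
    | two h1 h2 h3 =>
      exact chainDist_eq_left h (h.eq_add_two (β := 0) (by omega) (by omega) (by omega))
        (by omega) (by omega)
    | three' h1 h2 =>
      exact chainDist_eq_middle h (h.add_two_le hp (β := 1) (by omega) (by omega)) (by omega)
    | three h1 h2 h3 h4 =>
      exact chainDist_eq_left h (h.eq_add_two (β := 1) (by omega) (by omega) (by omega))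
        (by omega) (by omega)
    | four h1 h2 h3 h4 =>
      exact chainDist_eq_left_of_pos h hp (h.eq_add_two (β := 2) (by omega) (by omega) (by omega))
        (by omega) h1 (by omega)
    | five h1 h2 h3 h4 =>
      exact chainDist_eq_right h hp (h.add_two_le hp (β := 3) (by omega) h3) (by omega) h1
    | generic _ _ h1 h2 h3 => exact chainDist_of_band h h3 h2 h1
    | full _ h2 h3 => exact chainDist_full h h3 h2
    | full₂ h3 => exact chainDist_full₂ h (by omega) h3
    | zero => exact chainDist_full₃ h (by omega) (by omega)
  · rcases Nat.eq_zero_or_pos i with rfl | hi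
    · rcases Nat.eq_zero_or_pos j with rfl | hj
      · rcases Nat.eq_zero_or_pos k with rfl | hk0
        · exact ⟨_, .whole⟩
        rcases le_or_gt k (p ^ (s - 1)) with h1 | h1
        · exact ⟨_, .two (by omega) hk0 h1⟩
        · exact ⟨_, .three' h1 hk⟩
      rcases le_or_gt k (p ^ (s - 1)) with h1 | h1
      · exact ⟨_, .two (by omega) (by omega) h1⟩
      rcases le_or_gt k (2 * p ^ (s - 1)) with h2 | h2
      · exact ⟨_, .three hj (by omega) h1 h2⟩
      rcases le_or_gt k (3 * p ^ (s - 1)) with h3 | h3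
      · exact ⟨_, .four hj (by omega) h2 h3⟩
      · exact ⟨_, .five hj (by omega) h3 hk⟩
    · obtain ⟨τ₀, τ₁, τ₂, β₀, β₁, β₂, h1, h2, b₀, b₁, b₂⟩ | ⟨rfl, τ₁, τ₂, β₁, β₂, h1, b₁, b₂⟩ |
        ⟨rfl, rfl, τ₂, β₂, b₂⟩ | ⟨rfl, rfl, rfl⟩ := exists_bands hp hs hi hij hjk hk
      · exact ⟨_, .generic h1 h2 b₂ b₁ b₀⟩
      · exact ⟨_, .full h1 b₂ b₁⟩
      · exact ⟨_, .full₂ b₂⟩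
      · exact ⟨_, .zero⟩

theorem tableLinearMiddleAsc_iff (h : IsBandWeight p s M) (hp7 : 7 ≤ p) (hs : 0 < s)
    (hij : i ≤ j) (hjk : j ≤ k) (hk : k ≤ p ^ s) (d : ℕ) :
    TableLinearMiddleAsc p s i j k d ↔ chainDist M 3 4 k j i = d := by
  have hp : 2 ≤ p := by omega
  have hP : 0 < p ^ (s - 1) := pow_pos (by omega) _
  refine iff_eq_of_exists (T := TableLinearMiddleAsc p s i j k) (fun d hd => ?_) ?_ d
  · cases hd with
    | whole => exact chainDist_eq_left h (by simpa using h.zero) (by omega) (by omega)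
    | two h1 h2 h3 =>
      exact chainDist_eq_left h (h.eq_add_two (β := 0) (by omega) (by omega) (by omega))
        (by omega) (by omega)
    | three' h1 h2 =>
      exact chainDist_eq_middle h (h.add_two_le hp (β := 1) (by omega) (by omega)) (by omega)
    | three h1 h2 h3 h4 =>
      exact chainDist_eq_left h (h.eq_add_two (β := 1) (by omega) (by omega) (by omega))
        (by omega) (by omega)
    | four h1 h2 h3 h4 =>
      exact chainDist_eq_right h hp (h.add_two_le hp (β := 2) (by omega) h3) (by omega) h1
    | generic _ _ h1 h2 h3 => exact chainDist_of_band h h3 h2 h1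
    | full _ h2 h3 => exact chainDist_full h h3 h2
    | full₂ h3 => exact chainDist_full₂ h (by omega) h3
    | zero => exact chainDist_full₃ h (by omega) (by omega)
  · rcases Nat.eq_zero_or_pos i with rfl | hi
    · rcases Nat.eq_zero_or_pos j with rfl | hj
      · rcases Nat.eq_zero_or_pos k with rfl | hk0
        · exact ⟨_, .whole⟩
        rcases le_or_gt k (p ^ (s - 1)) with h1 | h1
        · exact ⟨_, .two (by omega) hk0 h1⟩
        · exact ⟨_, .three' h1 hk⟩
      rcases le_or_gt k (p ^ (s - 1)) with h1 | h1
      · exact ⟨_, .two (by omega) (by omega) h1⟩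
      rcases le_or_gt k (2 * p ^ (s - 1)) with h2 | h2
      · exact ⟨_, .three hj (by omega) h1 h2⟩
      · exact ⟨_, .four hj (by omega) h2 hk⟩
    · obtain ⟨τ₀, τ₁, τ₂, β₀, β₁, β₂, h1, h2, b₀, b₁, b₂⟩ | ⟨rfl, τ₁, τ₂, β₁, β₂, h1, b₁, b₂⟩ |
        ⟨rfl, rfl, τ₂, β₂, b₂⟩ | ⟨rfl, rfl, rfl⟩ := exists_bands hp hs hi hij hjk hk
      · exact ⟨_, .generic h1 h2 b₂ b₁ b₀⟩
      · exact ⟨_, .full h1 b₂ b₁⟩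
      · exact ⟨_, .full₂ b₂⟩
      · exact ⟨_, .zero⟩

end Tables

/-! ### The BCH bound -/

section BCH

variable {F K : Type*} [Field F] [Field K] [Algebra F K]

/-- A nonzero word of length `e` that vanishes at the points `α * β ^ k` with `k < d`, where `β` is
a primitive `e`-th root of unity, has weight greater than `d`: otherwise some polynomial of degree
less than `d` vanishes at `β ^ r` for all `r` but one in the support of the word. -/
theorem lt_card_support_of_aeval_eq_zero {e d : ℕ} {α β : K} (hα : α ≠ 0)
    (hβ : IsPrimitiveRoot β e) {v : F[X]} (hv : v ≠ 0) (hdeg : v.degree < (e : ℕ))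
    (hroot : ∀ k < d, aeval (α * β ^ k) v = 0) : d < v.support.card := by
  by_contra! hle
  have hlin : ∀ h : K[X], h.natDegree < d →
      ∑ r ∈ v.support, algebraMap F K (v.coeff r) * α ^ r * h.eval (β ^ r) = 0 := by
    intro h hh
    simp only [eval_eq_sum_range' hh, Finset.mul_sum]
    rw [Finset.sum_comm]
    refine Finset.sum_eq_zero fun k hk => ?_
    have hk := hroot k (Finset.mem_range.1 hk)
    rw [aeval_def, eval₂_eq_sum, sum_def] at hk
    rw [← mul_zero (h.coeff k), ← hk, Finset.mul_sum]
    exact Finset.sum_congr rfl fun r _ => by ring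
  obtain ⟨r₀, hr₀⟩ := support_nonempty.2 hv
  have hcard : (v.support.erase r₀).card < d := by
    have := card_support_pos hv
    rw [Finset.card_erase_of_mem hr₀]; omega
  have hlt : ∀ {r}, r ∈ v.support → r < e := fun {r} hr => by
    by_contra h
    exact mem_support_iff.1 hr ((degree_lt_iff_coeff_zero v e).1 hdeg r (by omega))
  have h := hlin (∏ r ∈ v.support.erase r₀, (X - C (β ^ r)))
    (by rwa [natDegree_finsetProd_X_sub_C_eq_card])
  rw [Finset.sum_eq_single_of_mem r₀ hr₀] at h
  · refine mul_ne_zero (mul_ne_zero ?_ (pow_ne_zero _ hα)) ?_ h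
    · rw [Ne, map_eq_zero]; exact mem_support_iff.1 hr₀
    · rw [eval_prod, Finset.prod_ne_zero_iff]
      intro r hr
      rw [eval_sub, eval_X, eval_C, sub_ne_zero]
      intro heq
      rw [Finset.mem_erase] at hr
      exact hr.1 (hβ.pow_inj (hlt hr₀) (hlt hr.2) heq).symm
  · intro r hr hne
    rw [eval_prod, Finset.prod_eq_zero (Finset.mem_erase.2 ⟨hne, hr⟩) (by simp), mul_zero]

end BCH

/-! ### The quadratic factors of `X ^ 5 - 1` -/

section Factors

variable {F K : Type*} [Field F] [Field K] [Algebra F K]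

/-- An element fixed by the `q`-power map lies in the subfield with `q` elements, since
`X ^ q - X` has at most `q` roots. -/
theorem mem_range_algebraMap_of_pow_card [Fintype F] {x : K} (hx : x ^ Fintype.card F = x) :
    x ∈ (algebraMap F K).range := by
  classical
  by_contra h
  have h1 : 1 < Fintype.card F := Fintype.one_lt_card
  have hne : (X ^ Fintype.card F - X : K[X]) ≠ 0 := FiniteField.X_pow_card_sub_X_ne_zero K h1
  have hnot : x ∉ Finset.univ.image (algebraMap F K) := by
    simpa [RingHom.mem_range] using h
  have hle := card_le_degree_of_subset_roots
    (p := (X ^ Fintype.card F - X : K[X])) (Z := insert x (Finset.univ.image (algebraMap F K))) (by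
      intro y hy
      rw [Finset.mem_val, Finset.mem_insert, Finset.mem_image] at hy
      rw [mem_roots hne, IsRoot, eval_sub, eval_pow, eval_X, sub_eq_zero]
      rcases hy with rfl | ⟨z, -, rfl⟩
      · exact hx
      · rw [← map_pow, FiniteField.pow_card])
  rw [Finset.card_insert_of_notMem hnot, Finset.card_image_of_injective _
    (algebraMap F K).injective, Finset.card_univ,
    FiniteField.X_pow_card_sub_X_natDegree_eq K h1] at hle
  omega

/-- `f₁ = (x - ω)(x - ω⁴)` and `f₂ = (x - ω²)(x - ω³)` for a primitive fifth root of unity `ω`. -/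
structure IsFactorPair (ω : K) (f₁ f₂ : F[X]) : Prop where
  prim : IsPrimitiveRoot ω 5
  map_left : f₁.map (algebraMap F K) = (X - C ω) * (X - C (ω ^ 4))
  map_right : f₂.map (algebraMap F K) = (X - C (ω ^ 2)) * (X - C (ω ^ 3))

namespace IsFactorPair

variable {ω : K} {f₁ f₂ : F[X]}

/-- Replacing `ω` by `ω ^ 2` exchanges the two factors. -/
theorem swap (h : IsFactorPair ω f₁ f₂) : IsFactorPair (ω ^ 2) f₂ f₁ := by
  have h5 := h.prim.pow_eq_one
  refine ⟨h.prim.pow_of_coprime 2 (by norm_num), ?_, ?_⟩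
  · rw [h.map_right, ← pow_mul, show 2 * 4 = 5 + 3 by rfl, pow_add ω, h5, one_mul]
  · rw [h.map_left, ← pow_mul, ← pow_mul, show 2 * 3 = 5 + 1 by rfl, pow_add ω, h5, one_mul,
      pow_one, mul_comm]

theorem monic (h : IsFactorPair ω f₁ f₂) : f₁.Monic := by
  refine Polynomial.monic_of_injective (algebraMap F K).injective ?_
  rw [h.map_left]
  exact (monic_X_sub_C _).mul (monic_X_sub_C _)

theorem natDegree_eq (h : IsFactorPair ω f₁ f₂) : f₁.natDegree = 2 := by
  rw [← natDegree_map (algebraMap F K), h.map_left, natDegree_mul (X_sub_C_ne_zero _)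
    (X_sub_C_ne_zero _), natDegree_X_sub_C, natDegree_X_sub_C]

theorem mul_mul_eq (h : IsFactorPair ω f₁ f₂) : (X - 1) * f₁ * f₂ = X ^ 5 - 1 := by
  apply map_injective (algebraMap F K) (algebraMap F K).injective
  have h5 := h.prim.pow_eq_one
  have hs := h.prim.geom_sum_eq_zero (by norm_num)
  simp only [Finset.sum_range_succ, Finset.sum_range_zero, zero_add, pow_zero, pow_one] at hs
  -- The sums of the roots of the two factors are the roots of `y ^ 2 + y - 1`.
  have hf1 : (X - C ω) * (X - C (ω ^ 4)) = X ^ 2 - C (ω + ω ^ 4) * X + 1 := by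
    rw [← C_1, ← h5]; simp only [map_add, map_pow]; ring
  have hf2 : (X - C (ω ^ 2)) * (X - C (ω ^ 3)) = X ^ 2 - C (ω ^ 2 + ω ^ 3) * X + 1 := by
    rw [← C_1, ← h5]; simp only [map_add, map_pow]; ring
  have e1 : (C (ω + ω ^ 4) + C (ω ^ 2 + ω ^ 3) : K[X]) = -1 := by
    rw [← C_add, ← C_1, ← C_neg]
    congr 1
    linear_combination hs
  have e2 : (C (ω + ω ^ 4) * C (ω ^ 2 + ω ^ 3) : K[X]) = -1 := by
    rw [← C_mul, ← C_1, ← C_neg]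
    congr 1
    linear_combination hs + (ω + ω ^ 2) * h5
  simp only [Polynomial.map_mul, Polynomial.map_sub, Polynomial.map_pow, map_X, Polynomial.map_one,
    h.map_left, h.map_right, hf1, hf2]
  linear_combination (X - 1) * (-(X ^ 3 + X)) * e1 + (X - 1) * X ^ 2 * e2

theorem aeval_X_sub_one (h : IsFactorPair ω f₁ f₂) {m : ℕ} (hm : m % 5 = 0) :
    aeval (ω ^ m) (X - 1 : F[X]) = 0 := by
  rw [map_sub, aeval_X, map_one, (h.prim.pow_eq_one_iff_dvd m).2 (Nat.dvd_of_mod_eq_zero hm),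
    sub_self]

theorem aeval_left (h : IsFactorPair ω f₁ f₂) {m : ℕ} (hm : m % 5 = 1 ∨ m % 5 = 4) :
    aeval (ω ^ m) f₁ = 0 := by
  rw [aeval_def, eval₂_eq_eval_map, h.map_left, ← Nat.div_add_mod m 5, pow_add, pow_mul,
    h.prim.pow_eq_one, one_pow, one_mul]
  rcases hm with hm | hm <;> simp [hm]

theorem aeval_right (h : IsFactorPair ω f₁ f₂) {m : ℕ} (hm : m % 5 = 2 ∨ m % 5 = 3) :
    aeval (ω ^ m) f₂ = 0 := by
  rw [aeval_def, eval₂_eq_eval_map, h.map_right, ← Nat.div_add_mod m 5, pow_add, pow_mul,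
    h.prim.pow_eq_one, one_pow, one_mul]
  rcases hm with hm | hm <;> simp [hm]

theorem irreducible [Fintype F] (h : IsFactorPair ω f₁ f₂) (h5 : 5 ∣ Fintype.card F + 1) :
    Irreducible f₁ := by
  -- A root of unity in `F` of order dividing `5` has order dividing both `q - 1` and `q + 1`.
  have hnot : ∀ k : ℕ, ¬ 5 ∣ k → ∀ x : F, algebraMap F K x ≠ ω ^ k := by
    intro k hk x hx
    have hxq : (ω ^ k) ^ Fintype.card F = ω ^ k := by
      rw [← hx, ← map_pow, FiniteField.pow_card]
    have h2 : ω ^ (2 * k) = 1 := by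
      calc ω ^ (2 * k) = ω ^ k * ω ^ k := by ring
        _ = (ω ^ k) ^ (Fintype.card F + 1) := by rw [pow_succ, hxq]
        _ = 1 := by
          rw [← pow_mul]
          exact (h.prim.pow_eq_one_iff_dvd _).2 (h5.mul_left k)
    have := (h.prim.pow_eq_one_iff_dvd _).1 h2
    omega
  refine irreducible_of_degree_le_three_of_not_isRoot (by rw [h.natDegree_eq]; decide)
    fun x hx => ?_
  have h0 : (f₁.map (algebraMap F K)).eval (algebraMap F K x) = 0 := by
    rw [eval_map_apply, hx.eq_zero, map_zero]
  rw [h.map_left, eval_mul, mul_eq_zero, eval_sub, eval_sub, eval_X, eval_C, eval_C, sub_eq_zero,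
    sub_eq_zero] at h0
  rcases h0 with h0 | h0
  · exact hnot 1 (by norm_num) x (by rw [h0, pow_one])
  · exact hnot 4 (by norm_num) x h0

theorem isCoprime (h : IsFactorPair ω f₁ f₂) (h5 : (5 : F) ≠ 0) :
    IsCoprime (X - 1) f₁ ∧ IsCoprime (X - 1) f₂ ∧ IsCoprime f₁ f₂ := by
  have hsep : ((X - 1) * f₁ * f₂).Separable := by
    rw [h.mul_mul_eq, X_pow_sub_one_separable_iff]; exact_mod_cast h5
  refine ⟨hsep.of_mul_left.isCoprime, ?_, ?_⟩
  · rw [mul_right_comm] at hsep; exact hsep.of_mul_left.isCoprime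
  · rw [mul_assoc] at hsep; exact hsep.of_mul_right.isCoprime

end IsFactorPair

/-- The roots `ω ^ k` and `ω ^ l` are inverse to each other and exchanged by the Frobenius map of `F`,
so that their sum lies in `F`. -/
theorem exists_map_eq [Fintype F] {ω : K} (hω : IsPrimitiveRoot ω 5)
    (h5 : 5 ∣ Fintype.card F + 1) {p : ℕ} [Fact p.Prime] [CharP K p] {m : ℕ}
    (hq : Fintype.card F = p ^ m) {k l : ℕ} (hkl : 5 ∣ k + l) :
    ∃ f : F[X], f.map (algebraMap F K) = (X - C (ω ^ k)) * (X - C (ω ^ l)) := by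
  have hfix : ∀ a b : ℕ, 5 ∣ a + b → (ω ^ a) ^ Fintype.card F = ω ^ b := by
    intro a b hab
    have h1 : ω ^ (a * (Fintype.card F + 1)) = 1 :=
      (hω.pow_eq_one_iff_dvd _).2 (h5.mul_left a)
    have h2 : ω ^ (a + b) = 1 := (hω.pow_eq_one_iff_dvd _).2 hab
    refine mul_left_cancel₀ (pow_ne_zero a (hω.ne_zero (by norm_num))) ?_
    rw [← pow_add, h2, ← pow_mul, ← pow_add, ← h1]
    ring
  obtain ⟨c, hc⟩ := RingHom.mem_range.1 (mem_range_algebraMap_of_pow_card (F := F)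
    (x := ω ^ k + ω ^ l) (by
      rw [hq, add_pow_char_pow, ← hq, hfix k l hkl, hfix l k (by rwa [add_comm]), add_comm]))
  have h1 : ω ^ k * ω ^ l = 1 := by
    rw [← pow_add]; exact (hω.pow_eq_one_iff_dvd _).2 hkl
  refine ⟨X ^ 2 - C c * X + 1, ?_⟩
  simp only [Polynomial.map_add, Polynomial.map_sub, Polynomial.map_mul, Polynomial.map_pow, map_X,
    map_C, Polynomial.map_one, hc]
  rw [C_add]
  have h2 : (C (ω ^ k) * C (ω ^ l) : K[X]) = 1 := by rw [← C_mul, h1, C_1]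
  linear_combination -h2

theorem exists_isPrimitiveRoot_five [Fintype K] (h : 5 ∣ Fintype.card K - 1) :
    ∃ ω : K, IsPrimitiveRoot ω 5 := by
  classical
  have : Fact (Nat.Prime 5) := ⟨by norm_num⟩
  obtain ⟨u, hu⟩ := exists_prime_orderOf_dvd_card (G := Kˣ) 5 (by rwa [Fintype.card_units])
  exact ⟨u, IsPrimitiveRoot.coe_units_iff.2 (hu ▸ IsPrimitiveRoot.orderOf u)⟩

end Factors

/-! ### Minimum distances -/

section Distances

variable {F K : Type*} [Field F] [Field K] [Algebra F K] {p s : ℕ} {ω : K} {f₁ f₂ : F[X]}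

/-- When the roots of `g₁` and of `g₁ * g₂` are consecutive powers of fifth roots of unity, up to a
factor, the codes `⟨g₁⟩` and `⟨g₁ * g₂⟩` of length `5` are maximum distance separable. -/
theorem minDist_eq_chainDist [Fact p.Prime] [CharP F p] {l₁ l₂ l₃ d₁ d₂ u₁ v₁ u₂ v₂ : ℕ}
    {g₁ g₂ g₃ : F[X]} (hω : IsPrimitiveRoot ω 5) (hg : g₁ * g₂ * g₃ = X ^ 5 - 1)
    (h₁₂ : IsCoprime g₁ g₂) (h₁₃ : IsCoprime g₁ g₃) (h₂₃ : IsCoprime g₂ g₃) (hgu : ¬ IsUnit g₃)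
    (hd₁ : g₁.natDegree ≤ d₁) (hd₂ : (g₁ * g₂).natDegree ≤ d₂)
    (hv₁ : Nat.Coprime v₁ 5) (hv₂ : Nat.Coprime v₂ 5)
    (hr₁ : ∀ k < d₁, aeval (ω ^ (u₁ + v₁ * k)) g₁ = 0)
    (hr₂ : ∀ k < d₂, aeval (ω ^ (u₂ + v₂ * k)) (g₁ * g₂) = 0)
    (h32 : l₃ ≤ l₂) (h21 : l₂ ≤ l₁) (h1s : l₁ ≤ p ^ s) :
    minDist (generatedBy (5 * p ^ s) (g₁ ^ l₁ * g₂ ^ l₂ * g₃ ^ l₃)) =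
      chainDist (minWeight F (p ^ s)) (d₁ + 1) (d₂ + 1) l₁ l₂ l₃ := by
  have hω0 : ω ≠ 0 := hω.ne_zero (by norm_num)
  have hbch : ∀ {u w d : ℕ} {g : F[X]}, Nat.Coprime w 5 →
      (∀ k < d, aeval (ω ^ (u + w * k)) g = 0) →
      ∀ v : F[X], v ≠ 0 → v.degree < (5 : ℕ) → g ∣ v → d + 1 ≤ v.support.card := by
    rintro u w d g hw hr v hv hdeg ⟨h, rfl⟩
    refine lt_card_support_of_aeval_eq_zero (pow_ne_zero u hω0) (hω.pow_of_coprime w hw) hv hdeg ?_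
    intro k hk
    rw [← pow_mul, ← pow_add, map_mul, hr k hk, zero_mul]
  rw [chainDist]
  exact minDist_generatedBy_mul_pow (by norm_num) hg h₁₂ h₁₃ h₂₃ hgu (hbch hv₁ hr₁)
    ((card_supp_le_succ_natDegree _).trans (by omega)) (hbch hv₂ hr₂)
    ((card_supp_le_succ_natDegree _).trans (by omega)) h32 h21 h1s

namespace IsFactorPair

theorem not_isUnit (h : IsFactorPair ω f₁ f₂) : ¬ IsUnit f₁ := fun hu => by
  have := natDegree_eq_zero_of_isUnit hu
  rw [h.natDegree_eq] at this
  omega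

theorem natDegree_X_sub_one_mul (h : IsFactorPair ω f₁ f₂) : ((X - 1) * f₁).natDegree = 3 := by
  rw [← C_1, natDegree_mul (X_sub_C_ne_zero _) h.monic.ne_zero, natDegree_X_sub_C, h.natDegree_eq]

/-- The chain `X - 1`, `f₁`, `f₂`. The roots of `(X - 1) * f₁` are `ω ^ 4`, `ω ^ 5`, `ω ^ 6`. -/
theorem minDist_linear_first [Fact p.Prime] [CharP F p] (h : IsFactorPair ω f₁ f₂)
    (h5 : (5 : F) ≠ 0) {i j k : ℕ} (hkj : k ≤ j) (hji : j ≤ i) (hi : i ≤ p ^ s) :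
    minDist (generatedBy (5 * p ^ s) ((X - 1) ^ i * f₁ ^ j * f₂ ^ k)) =
      chainDist (minWeight F (p ^ s)) 2 4 i j k := by
  obtain ⟨c1, c2, c3⟩ := h.isCoprime h5
  refine minDist_eq_chainDist (d₁ := 1) (d₂ := 3) (u₁ := 0) (v₁ := 1) (u₂ := 4) (v₂ := 1) h.prim
    h.mul_mul_eq c1 c2 c3 h.swap.not_isUnit ?_ h.natDegree_X_sub_one_mul.le (by norm_num)
    (by norm_num) ?_ ?_ hkj hji hi
  · rw [← C_1, natDegree_X_sub_C]
  · intro k hk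
    exact h.aeval_X_sub_one (by omega)
  · intro k hk
    rw [map_mul]
    by_cases hk1 : k = 1
    · rw [h.aeval_X_sub_one (by omega), zero_mul]
    · rw [h.aeval_left (by omega), mul_zero]

/-- The chain `f₁`, `X - 1`, `f₂`. The roots of `f₁` are `ω ^ 4` and `ω ^ 6`. -/
theorem minDist_linear_second [Fact p.Prime] [CharP F p] (h : IsFactorPair ω f₁ f₂)
    (h5 : (5 : F) ≠ 0) {i j k : ℕ} (hkj : k ≤ j) (hji : j ≤ i) (hi : i ≤ p ^ s) :
    minDist (generatedBy (5 * p ^ s) (f₁ ^ i * (X - 1) ^ j * f₂ ^ k)) =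
      chainDist (minWeight F (p ^ s)) 3 4 i j k := by
  obtain ⟨c1, c2, c3⟩ := h.isCoprime h5
  refine minDist_eq_chainDist (d₁ := 2) (d₂ := 3) (u₁ := 4) (v₁ := 2) (u₂ := 4) (v₂ := 1) h.prim
    (by rw [mul_comm f₁, h.mul_mul_eq]) c1.symm c3 c2 h.swap.not_isUnit h.natDegree_eq.le
    (by rw [mul_comm f₁, h.natDegree_X_sub_one_mul]) (by norm_num) (by norm_num) ?_ ?_ hkj hji hi
  · intro k hk
    exact h.aeval_left (by interval_cases k <;> simp)
  · intro k hk
    rw [map_mul]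
    by_cases hk1 : k = 1
    · rw [h.aeval_X_sub_one (by omega), mul_zero]
    · rw [h.aeval_left (by omega), zero_mul]

/-- The chain `f₁`, `f₂`, `X - 1`. The roots of `f₁ * f₂` are `ω`, `ω ^ 2`, `ω ^ 3`, `ω ^ 4`. -/
theorem minDist_linear_last [Fact p.Prime] [CharP F p] (h : IsFactorPair ω f₁ f₂)
    (h5 : (5 : F) ≠ 0) {i j k : ℕ} (hkj : k ≤ j) (hji : j ≤ i) (hi : i ≤ p ^ s) :
    minDist (generatedBy (5 * p ^ s) (f₁ ^ i * f₂ ^ j * (X - 1) ^ k)) =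
      chainDist (minWeight F (p ^ s)) 3 5 i j k := by
  obtain ⟨c1, c2, c3⟩ := h.isCoprime h5
  refine minDist_eq_chainDist (d₁ := 2) (d₂ := 4) (u₁ := 4) (v₁ := 2) (u₂ := 1) (v₂ := 1) h.prim
    (by rw [mul_comm, ← mul_assoc, h.mul_mul_eq]) c3 c1.symm c2.symm
    (by rw [← C_1]; exact not_isUnit_X_sub_C 1) h.natDegree_eq.le ?_ (by norm_num) (by norm_num)
    ?_ ?_ hkj hji hi
  · exact natDegree_mul_le.trans (by rw [h.natDegree_eq, h.swap.natDegree_eq])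
  · intro k hk
    exact h.aeval_left (by interval_cases k <;> simp)
  · intro k hk
    rw [map_mul]
    by_cases hk1 : k = 0 ∨ k = 3
    · rw [h.aeval_left (by omega), zero_mul]
    · rw [h.aeval_right (by omega), mul_zero]

end IsFactorPair

end Distances

end CyclicCodes

theorem mainTheorem2 (p m s q : ℕ) (hp : p.Prime) (hp7 : 7 ≤ p) (hm : 0 < m) (hs : 0 < s)
    (hq : q = p ^ m) (h5 : 5 ∣ q + 1) (h5' : ¬ 5 ∣ q - 1)
    {F : Type*} [Field F] [Fintype F] (hF : Fintype.card F = q)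
    {K : Type*} [Field K] [Fintype K] [Algebra F K] (hK : Fintype.card K = q ^ 2) :
    (∃ ω : K, IsPrimitiveRoot ω 5) ∧
    ∀ ω : K, IsPrimitiveRoot ω 5 → ∃ f₁ f₂ : F[X],
      -- `f₁ = (x - ω)(x - ω⁴)` and `f₂ = (x - ω²)(x - ω³)`
      f₁.map (algebraMap F K) = (X - C ω) * (X - C (ω ^ 4)) ∧
      f₂.map (algebraMap F K) = (X - C (ω ^ 2)) * (X - C (ω ^ 3)) ∧
      Irreducible f₁ ∧ Irreducible f₂ ∧
      (X ^ 5 - 1 : F[X]) = (X - 1) * f₁ * f₂ ∧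
      (∀ 𝒞 : Submodule F (Fin (5 * p ^ s) → F), CyclicCodes.IsCyclicCode 𝒞 ↔
        ∃ i j k : ℕ, i ≤ p ^ s ∧ j ≤ p ^ s ∧ k ≤ p ^ s ∧
          𝒞 = CyclicCodes.generatedBy (5 * p ^ s) ((X - 1) ^ i * f₁ ^ j * f₂ ^ k)) ∧
      (∀ i j k d : ℕ, k ≤ j → j ≤ i → i ≤ p ^ s →
        (CyclicCodes.TableLinearTop p s i j k d ↔
          CyclicCodes.minDist
            (CyclicCodes.generatedBy (5 * p ^ s) ((X - 1) ^ i * f₁ ^ j * f₂ ^ k)) = d) ∧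
        (CyclicCodes.TableLinearTop p s i j k d ↔
          CyclicCodes.minDist
            (CyclicCodes.generatedBy (5 * p ^ s) ((X - 1) ^ i * f₂ ^ j * f₁ ^ k)) = d) ∧
        (CyclicCodes.TableLinearMiddleDesc p s i j k d ↔
          CyclicCodes.minDist
            (CyclicCodes.generatedBy (5 * p ^ s) (f₁ ^ i * (X - 1) ^ j * f₂ ^ k)) = d)) ∧
      (∀ i j k d : ℕ, i ≤ j → j ≤ k → k ≤ p ^ s →
        (CyclicCodes.TableLinearBottom p s i j k d ↔
          CyclicCodes.minDist
            (CyclicCodes.generatedBy (5 * p ^ s) ((X - 1) ^ i * f₁ ^ j * f₂ ^ k)) = d) ∧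
        (CyclicCodes.TableLinearBottom p s i j k d ↔
          CyclicCodes.minDist
            (CyclicCodes.generatedBy (5 * p ^ s) ((X - 1) ^ i * f₂ ^ j * f₁ ^ k)) = d) ∧
        (CyclicCodes.TableLinearMiddleAsc p s i j k d ↔
          CyclicCodes.minDist
            (CyclicCodes.generatedBy (5 * p ^ s) (f₁ ^ i * (X - 1) ^ j * f₂ ^ k)) = d)) := by
  have : Fact p.Prime := ⟨hp⟩
  have hFp : Fintype.card F = p ^ m := hF.trans hq
  have : CharP F p := by
    exact charP_of_card_eq_prime_pow hFp
  have : CharP K p := charP_of_injective_algebraMap (algebraMap F K).injective p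
  have h5q : 5 ∣ Fintype.card F + 1 := hF ▸ h5
  have h5F : (5 : F) ≠ 0 := by
    intro h0
    have h1 : p ∣ 5 := (CharP.cast_eq_zero_iff F p 5).1 (by exact_mod_cast h0)
    have := Nat.le_of_dvd (by norm_num) h1
    omega
  have hM := CyclicCodes.isBandWeight_minWeight (p := p) F hs
  refine ⟨CyclicCodes.exists_isPrimitiveRoot_five ?_, fun ω hω => ?_⟩
  · rw [hK, show q ^ 2 - 1 = (q + 1) * (q - 1) by rw [← Nat.sq_sub_sq, one_pow]]
    exact h5.mul_right _
  obtain ⟨f₁, hf₁⟩ := CyclicCodes.exists_map_eq hω h5q hFp (k := 1) (l := 4) (by norm_num)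
  obtain ⟨f₂, hf₂⟩ := CyclicCodes.exists_map_eq hω h5q hFp (k := 2) (l := 3) (by norm_num)
  rw [pow_one] at hf₁
  have h : CyclicCodes.IsFactorPair ω f₁ f₂ := ⟨hω, hf₁, hf₂⟩
  have hirr₁ := h.irreducible h5q
  have hirr₂ := h.swap.irreducible h5q
  have hn : 0 < 5 * p ^ s := Nat.mul_pos (by norm_num) (pow_pos hp.pos s)
  refine ⟨f₁, f₂, hf₁, hf₂, hirr₁, hirr₂, h.mul_mul_eq.symm, fun 𝒞 => ?_,
    fun i j k d hkj hji hi => ⟨?_, ?_, ?_⟩, fun i j k d hij hjk hk => ⟨?_, ?_, ?_⟩⟩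
  · refine CyclicCodes.isCyclicCode_iff_exists_exponents hn
      (by rw [← C_1]; exact irreducible_X_sub_C 1) hirr₁ hirr₂ ?_ 𝒞
    rw [pow_mul, ← mul_pow, ← mul_pow, h.mul_mul_eq, sub_pow_char_pow, one_pow]
  · rw [h.minDist_linear_first h5F hkj hji hi]
    exact CyclicCodes.tableLinearTop_iff hM hp7 hs hkj hji hi d
  · rw [h.swap.minDist_linear_first h5F hkj hji hi]
    exact CyclicCodes.tableLinearTop_iff hM hp7 hs hkj hji hi d
  · rw [h.minDist_linear_second h5F hkj hji hi]
    exact CyclicCodes.tableLinearMiddleDesc_iff hM hp7 hs hkj hji hi d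
  · rw [show (X - 1) ^ i * f₁ ^ j * f₂ ^ k = f₂ ^ k * f₁ ^ j * (X - 1) ^ i by ring,
      h.swap.minDist_linear_last h5F hij hjk hk]
    exact CyclicCodes.tableLinearBottom_iff hM hp7 hs hij hjk hk d
  · rw [show (X - 1) ^ i * f₂ ^ j * f₁ ^ k = f₁ ^ k * f₂ ^ j * (X - 1) ^ i by ring,
      h.minDist_linear_last h5F hij hjk hk]
    exact CyclicCodes.tableLinearBottom_iff hM hp7 hs hij hjk hk d
  · rw [show f₁ ^ i * (X - 1) ^ j * f₂ ^ k = f₂ ^ k * (X - 1) ^ j * f₁ ^ i by ring,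
      h.swap.minDist_linear_second h5F hij hjk hk]
    exact CyclicCodes.tableLinearMiddleAsc_iff hM hp7 hs hij hjk hk d
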